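/- Let $C\ge 1$ be the number of classes, let $\mathcal{F}$ be a class of measurable models $f:\mathcal X\to\mathbb R^C$ which is pointwise separable (it has a countable subset $\mathcal F_0$ such that each $f\in\mathcal F$ is a pointwise limit of a sequence in $\mathcal F_0$), and let $\mathcal D$ be a probability distribution of pairs (point, true label) on $\mathcal X\times\{1,\dots,C\}$. For step $t=0,1,2,\dots$ let $P^{(t)}=(P^{(t)}_1,\dots,P^{(t)}_C)$ be fixed (non-random) class priors ($P^{(t)}_y>0$, $\sum_y P^{(t)}_y=1$), and let $$\ell_t(u,y)=-\log\frac{e^{L_y(u)+\ln P^{(t)}_y}}{\sum_{y'=1}^{C}e^{L_{y'}(u)+\ln P^{(t)}_{y'}}}$$ be the logit-adjusted loss at the model output $u=f(x)\in\mathbb R^C$ and the label $y$, where $L(u)\in\mathbb R^C$ is the vector of logits read off the output by a fixed measurable map $L$ ($L(u)=u$ if the model outputs logits, $L(u)=\log u$ coordinatewise if it outputs class probabilities). Assume that on the set of outputs $\{f(x): f\in\mathcal F,\,x\in\mathcal X\}$ the function $u\mapsto \ell_t(u,y)$ is, for every $y$ and $t$, $\rho$-Lipschitz in the Euclidean norm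 and bounded above by $U$. Let $(x_i,y_i)$, $1\le i\le N$ ($N\ge1$), be the labeled sample and, for each step $t\ge1$, let $(x^t_j,y^t_j)$, $1\le j\le \hat M_t$, be the points selected for pseudo-labeling, with their true labels $y_j^t$ and with arbitrary pseudo-labels $\hat y^t_j$ (which may depend on all the data). The numbers $\hat M_t$ are non-random, and for each fixed $t$ the $O_t=N+\hat M_t$ training pairs $(x_i,y_i)$, $(x^t_j,y^t_j)$ are independent with law $\mathcal D$; the samples of different steps may depend on each other in any way. Let $f_t\in\mathcal F$ be the model at step $t$ (it may depend on all the data), let $\lambda_t\ge 0$ be the (possibly random) empirical risk reduction at step $t$, let $\epsilon_t=\frac1{\hat M_t}\#\{j:\hat y^t_j\ne y^t_j\}$ be the pseudo-labeling error rate at step $t$ ($\epsilon_t=0$ if $\hat M_t=0$), and define $$R_0=\frac1N\sum_{i=1}^N\ell_0(f_0(x_i),y_i),\qquad R_t=R_{t-1}-\lambda_t+I_{\epsilon_t}+I_{O_t}\quad(t\ge1),$$ $$I_{\epsilon_t}=\Big|\frac1{\hat M_t}\sum_{j=1}^{\hat M_t}\ell_t(f_t(x^t_j),\hat y^t_j)-\frac1{\hat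 M_t}\sum_{j=1}^{\hat M_t}\ell_t(f_t(x^t_j),y^t_j)\Big|\quad(=0\text{ if }\hat M_t=0),$$ $$I_{O_t}=\Big|\mathbb E_{(x,y)\sim\mathcal D}\,\ell_t(h(x),y)\Big|_{h=f_t}-\frac1{O_t}\Big[\sum_{i=1}^N\ell_t(f_t(x_i),y_i)+\sum_{j=1}^{\hat M_t}\ell_t(f_t(x^t_j),y^t_j)\Big]\Big|.$$ For a class $\mathcal H$ of real functions on $\mathcal X$ let $\mathcal R_n(\mathcal H)=\mathbb E_{x,\sigma}\big[\sup_{h\in\mathcal H}\frac1n\sum_{i=1}^n\sigma_ih(x_i)\big]\in[0,\infty]$ be its expected Rademacher complexity, where the $x_i$ are independent points distributed as the first component of $\mathcal D$ and $\sigma$ is uniform in $\{-1,1\}^n$; let $\mathcal H_y=\{x\mapsto f_y(x): f\in\mathcal F\}$. Then for every $T\ge0$ and every $\upsilon>0$, with probability at least $1-\upsilon$, $$R_T\le R_0-\sum_{t=1}^T\lambda_t+U\sum_{t=1}^T\epsilon_t+4\sqrt2\,\rho\sum_{t=1}^T\sum_{y=1}^C\mathcal R_{O_t}(\mathcal H_y)+2U\sum_{t=1}^T\sqrt{\frac{\log(2/\upsilon)}{2O_t}}.$$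 (For $\upsilon\ge 1$ there is nothing to prove, and for $\upsilon>2$ the square root is read as $0$. If $\rho=0$, the term with the Rademacher complexities is read as $0$.) -/

import Mathlib

open MeasureTheory ProbabilityTheory Filter Topology
open scoped ENNReal NNReal

noncomputable section

namespace CPG

/-- The logit-adjusted softmax cross-entropy loss with class priors `P`, at the logits `z` and the
label `y`. -/
def laLoss {C : ℕ} (P : Fin C → ℝ) (z : Fin C → ℝ) (y : Fin C) : ℝ :=
  -Real.log (Real.exp (z y + Real.log (P y)) / ∑ y', Real.exp (z y' + Real.log (P y')))

/-- Space of the model outputs `f x`, with the Euclidean norm. -/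
abbrev Output (C : ℕ) : Type := EuclideanSpace ℝ (Fin C)

/-- The logit-adjusted loss as a function of the model output `u`. The map `L` reads the logits off
the output: `L u = u` if the model outputs logits, `L u = log u` (coordinatewise) if it outputs
predicted class probabilities. -/
def outputLoss {C : ℕ} (P : Fin C → ℝ) (L : Output C → Fin C → ℝ) (u : Output C) (y : Fin C) : ℝ :=
  laLoss P (L u) y

/-- All values `f x` taken by the models of the class `F`. -/
def outputs {X : Type*} {C : ℕ} (F : Set (X → Output C)) : Set (Output C) :=
  {u | ∃ f ∈ F, ∃ x, f x = u}

/-- The function space `H_y` of the functions `x ↦ f_y(x)`, `f ∈ F`. -/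
def classOutputs {X : Type*} {C : ℕ} (F : Set (X → Output C)) (y : Fin C) : Set (X → ℝ) :=
  {h | ∃ f ∈ F, h = fun x => f x y}

/-- The expected Rademacher complexity `E_x E_σ sup_{h ∈ H} (1/n) ∑ i, σ i * h (x i)`, with `x` a
sample of `n` independent points of law `ν` and `σ` uniform in `{-1, 1}^n`. The supremum is taken in
`EReal` and the result lies in `[0, ∞]`, so that an unbounded class has no junk value. (For nonempty
`H` the mean over `σ` is nonnegative, since `σ` and `-σ` have the same law.) -/
def rademacher {X : Type*} [MeasurableSpace X] (ν : Measure X) (n : ℕ) (H : Set (X → ℝ)) : ℝ≥0∞ :=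
  ∫⁻ x : Fin n → X,
    (∑ σ : Fin n → ℤˣ, ⨆ h ∈ H, (((∑ i, ((σ i : ℤ) : ℝ) * h (x i)) / n : ℝ) : EReal)).toENNReal
      / 2 ^ n ∂(Measure.pi fun _ => ν)

/-- Pointwise separability of a function class, the usual condition that makes suprema over it
measurable. -/
def PointwiseSeparable {X : Type*} {C : ℕ} (F : Set (X → Output C)) : Prop :=
  ∃ F₀ ⊆ F, F₀.Countable ∧ ∀ f ∈ F, ∃ u : ℕ → X → Output C,
    (∀ n, u n ∈ F₀) ∧ ∀ x, Tendsto (fun n => u n x) atTop (𝓝 (f x))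

/-- The true risk `E_{(x,y)} ℓ(f(x), y)`. -/
def trueRisk {X : Type*} [MeasurableSpace X] {C : ℕ} (D : Measure (X × Fin C))
    (l : Output C → Fin C → ℝ) (f : X → Output C) : ℝ :=
  ∫ p, l (f p.1) p.2 ∂D

/-- The empirical risk (average loss) of `f` on a finite family of labeled points. -/
def empRisk {X : Type*} {C : ℕ} {ι : Type*} [Fintype ι] (l : Output C → Fin C → ℝ)
    (z : ι → X × Fin C) (f : X → Output C) : ℝ :=
  (∑ i, l (f (z i).1) (z i).2) / Fintype.card ι

/-- The pseudo-labeling error rate: the fraction of the points `s j` (with true label `(s j).2`)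
whose pseudo-label `yhat j` is wrong. -/
def errorRate {X : Type*} {C m : ℕ} (s : Fin m → X × Fin C) (yhat : Fin m → Fin C) : ℝ :=
  ((Finset.univ.filter fun j => yhat j ≠ (s j).2).card : ℝ) / m

/-- Impact `I_ε` of the noisy pseudo-labels: the difference between the empirical risks on the
pseudo-labeled points with pseudo-labels and with true labels. -/
def noiseImpact {X : Type*} {C m : ℕ} (l : Output C → Fin C → ℝ) (s : Fin m → X × Fin C)
    (yhat : Fin m → Fin C) (f : X → Output C) : ℝ :=
  |empRisk l (fun j => ((s j).1, yhat j)) f - empRisk l s f|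

/-- Impact `I_O` of the number of training samples: the deviation between the true risk and the
empirical risk on the training sample `z` with true labels. -/
def sampleImpact {X : Type*} [MeasurableSpace X] {C : ℕ} {ι : Type*} [Fintype ι]
    (D : Measure (X × Fin C)) (l : Output C → Fin C → ℝ) (z : ι → X × Fin C)
    (f : X → Output C) : ℝ :=
  |trueRisk D l f - empRisk l z f|

/-- The model empirical risk: `R_t = R_{t-1} - λ_t + I_{ε_t} + I_{O_t}`, started at `R₀`. -/
def modelRisk (R₀ : ℝ) (lam Ieps Isam : ℕ → ℝ) : ℕ → ℝ
  | 0 => R₀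
  | t + 1 => modelRisk R₀ lam Ieps Isam t - lam (t + 1) + Ieps (t + 1) + Isam (t + 1)

end CPG

end

/-! Unrolling the recursion leaves two sums to bound. Since the loss lies in `[0, U]`, a wrong
pseudo-label changes one term of the average by at most `U`, so the noise impacts sum to at most `U
∑ ε_t`.

The sample impacts are bounded uniformly over the class, on an event fixed before any model is
chosen; this is why the models may depend on all the data. For one step and a finite family of
models, McDiarmid's inequality controls the exponential moment of the largest deviation around its
mean (`integral_exp_le_of_bounded_differences`). Symmetrization bounds that mean by twice a
Rademacher average of the losses (`symmetrization_offset`), and a vector contraction principle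
passes from the losses to the coordinates of the models (`contraction`). Khintchine's inequality
with constant `2` gives contraction factor `2ρ`, hence `4ρ` in total, which is below the required
`4√2 ρ`.

The steps may be dependent, but no union bound is needed: Jensen's inequality with suitable weights
bounds the exponential moment of the sum (`measureReal_sum_ge_le`), and the deviations add up. The
two signs of the deviation cost the factor `2` in `log (2 / υ)`. This yields `U` in front of the
square roots, where `2U` is required.

Pointwise separability extends the bound from finite families to a countable dense one by continuity
from above of the measure, then to the whole class by dominated convergence
(`exists_event_sum_sampleImpact_le`). -/

noncomputable section

namespace CPG

open Finset
open scoped BigOperators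

/-! ### Moments of Rademacher sums and Khintchine's inequality. -/

section Signs

theorem expect_fin_succ_pi {α : Type*} [Fintype α] {n : ℕ} (f : (Fin (n + 1) → α) → ℝ) :
    𝔼 x, f x = 𝔼 a, 𝔼 x : Fin n → α, f (Fin.cons a x) := by
  rw [← Finset.expect_product' univ univ (fun a (x : Fin n → α) => f (Fin.cons a x)),
    univ_product_univ]
  exact (Fintype.expect_equiv (Fin.consEquiv fun _ => α) _ _ fun _ => rfl).symm

theorem expect_intUnits (f : ℤˣ → ℝ) : 𝔼 s, f s = (f 1 + f (-1)) / 2 := by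
  rw [Fintype.expect_eq_sum_div_card, show (univ : Finset ℤˣ) = {1, -1} from rfl,
    Finset.sum_pair (by decide)]
  simp [Fintype.card_units_int]

theorem expect_pi_eval {α κ : Type*} [Fintype α] [Nonempty α] [Fintype κ] [DecidableEq κ] (y : κ)
    (g : α → ℝ) : 𝔼 τ : κ → α, g (τ y) = 𝔼 a, g a := by
  have h := Fintype.sum_piFinset_apply g univ y
  rw [Fintype.piFinset_univ] at h
  have hc : (0 : ℝ) < Fintype.card α := by exact_mod_cast Fintype.card_pos
  have hy : Fintype.card κ - 1 + 1 = Fintype.card κ :=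
    Nat.sub_add_cancel (Fintype.card_pos_iff.2 ⟨y⟩)
  rw [Fintype.expect_eq_sum_div_card, Fintype.expect_eq_sum_div_card, h, Fintype.card_fun]
  rw [← hy]
  simp only [card_univ, nsmul_eq_mul, Nat.cast_pow, Nat.add_sub_cancel]
  field_simp
  ring

/-- The signed sum `∑ i, σ i * v i`. -/
def signSum {κ : Type*} [Fintype κ] (σ : κ → ℤˣ) (v : κ → ℝ) : ℝ := ∑ i, ((σ i : ℤ) : ℝ) * v i

theorem signSum_cons {n : ℕ} (s : ℤˣ) (σ : Fin n → ℤˣ) (v : Fin (n + 1) → ℝ) :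
    signSum (Fin.cons s σ : Fin (n + 1) → ℤˣ) v = ((s : ℤ) : ℝ) * v 0 + signSum σ (Fin.tail v) := by
  simp [signSum, Fin.sum_univ_succ, Fin.tail]

theorem signSum_neg {κ : Type*} [Fintype κ] (σ : κ → ℤˣ) (v : κ → ℝ) :
    signSum (-σ) v = -signSum σ v := by
  simp [signSum]

theorem signSum_neg_right {κ : Type*} [Fintype κ] (σ : κ → ℤˣ) (v : κ → ℝ) :
    signSum σ (fun i => -v i) = -signSum σ v := by
  simp [signSum]

theorem signSum_sub {κ : Type*} [Fintype κ] (σ : κ → ℤˣ) (v w : κ → ℝ) :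
    signSum σ (fun i => v i - w i) = signSum σ v - signSum σ w := by
  simp [signSum, mul_sub]

theorem expect_neg_signs {κ : Type*} [Fintype κ] [DecidableEq κ] (g : (κ → ℤˣ) → ℝ) :
    𝔼 σ, g (-σ) = 𝔼 σ, g σ :=
  Fintype.expect_equiv (Equiv.neg _) _ _ fun _ => rfl

theorem expect_signSum {n : ℕ} (v : Fin n → ℝ) : 𝔼 σ : Fin n → ℤˣ, signSum σ v = 0 := by
  have h := expect_neg_signs (fun σ : Fin n → ℤˣ => signSum σ v)
  simp only [signSum_neg, expect_neg_distrib] at h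
  linarith

theorem expect_signSum_sq {n : ℕ} (v : Fin n → ℝ) :
    𝔼 σ : Fin n → ℤˣ, signSum σ v ^ 2 = ∑ i, v i ^ 2 := by
  induction n with
  | zero => simp [signSum]
  | succ n ih =>
    rw [expect_fin_succ_pi, expect_intUnits, Fin.sum_univ_succ, ← expect_add_distrib,
      show ∑ i : Fin n, v i.succ ^ 2 = ∑ i, Fin.tail v i ^ 2 from rfl, ← ih (Fin.tail v),
      Finset.expect_div]
    simp only [signSum_cons, Units.val_one, Units.val_neg, Int.cast_one, Int.cast_neg]
    have : ∀ σ : Fin n → ℤˣ, ((1 * v 0 + signSum σ (Fin.tail v)) ^ 2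
        + (-1 * v 0 + signSum σ (Fin.tail v)) ^ 2) / 2 = v 0 ^ 2 + signSum σ (Fin.tail v) ^ 2 :=
      fun σ => by ring
    simp only [this, expect_add_distrib, Fintype.expect_const]

theorem expect_signSum_pow_four_le {n : ℕ} (v : Fin n → ℝ) :
    𝔼 σ : Fin n → ℤˣ, signSum σ v ^ 4 ≤ 3 * (∑ i, v i ^ 2) ^ 2 := by
  induction n with
  | zero => simp [signSum]
  | succ n ih =>
    have h4 := ih (Fin.tail v)
    have h2 := expect_signSum_sq (Fin.tail v)
    rw [expect_fin_succ_pi, expect_intUnits, Fin.sum_univ_succ, ← expect_add_distrib,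
      show ∑ i : Fin n, v i.succ ^ 2 = ∑ i, Fin.tail v i ^ 2 from rfl, Finset.expect_div]
    simp only [signSum_cons, Units.val_one, Units.val_neg, Int.cast_one, Int.cast_neg]
    have : ∀ σ : Fin n → ℤˣ, ((1 * v 0 + signSum σ (Fin.tail v)) ^ 4
        + (-1 * v 0 + signSum σ (Fin.tail v)) ^ 4) / 2
        = v 0 ^ 4 + 6 * v 0 ^ 2 * signSum σ (Fin.tail v) ^ 2 + signSum σ (Fin.tail v) ^ 4 :=
      fun σ => by ring
    simp only [this, expect_add_distrib, Fintype.expect_const, ← mul_expect, h2]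
    nlinarith [sq_nonneg (v 0 ^ 2)]

/-- Khintchine's inequality between the first and the second moment, with the constant `2`. -/
theorem sqrt_sum_sq_le_expect_abs_signSum {n : ℕ} (v : Fin n → ℝ) :
    √(∑ i, v i ^ 2) ≤ 2 * 𝔼 σ : Fin n → ℤˣ, |signSum σ v| := by
  set r := √(∑ i, v i ^ 2) with hr
  have hr0 : 0 ≤ r := Real.sqrt_nonneg _
  have hr2 : ∑ i, v i ^ 2 = r ^ 2 := (Real.sq_sqrt (sum_nonneg fun i _ => sq_nonneg _)).symm
  have h2 := expect_signSum_sq v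
  have h4 := expect_signSum_pow_four_le v
  rw [hr2] at h2 h4
  -- With `a = |signSum σ v|`, the difference of the two sides is `a (a - 2r)² (a + 4r) ≥ 0`.
  -- Averaging with second moment `r²` and fourth moment at most `3r⁴` gives `9r⁴ ≤ 16r³ 𝔼 a`, and
  -- `16/9 ≤ 2`.
  have hpt : ∀ σ : Fin n → ℤˣ,
      12 * r ^ 2 * signSum σ v ^ 2 - signSum σ v ^ 4 ≤ 16 * r ^ 3 * |signSum σ v| := by
    intro σ
    have ha := abs_nonneg (signSum σ v)
    rw [← sq_abs (signSum σ v), show signSum σ v ^ 4 = |signSum σ v| ^ 4 from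
      (Even.pow_abs (by decide) _).symm]
    generalize |signSum σ v| = a at ha
    have : 0 ≤ a * (a - 2 * r) ^ 2 * (a + 4 * r) := by positivity
    nlinarith
  have h := Finset.expect_le_expect (s := univ) fun σ _ => hpt σ
  rw [expect_sub_distrib, ← mul_expect, ← mul_expect, h2] at h
  rcases hr0.eq_or_lt with h0 | h0
  · rw [← h0]
    exact mul_nonneg zero_le_two (expect_nonneg fun _ _ => abs_nonneg _)
  · have h3 : 0 < r ^ 3 := by positivity
    have : r ^ 3 * (9 * r) ≤ r ^ 3 * (16 * 𝔼 σ : Fin n → ℤˣ, |signSum σ v|) := by nlinarith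
    have := le_of_mul_le_mul_left this h3
    linarith

end Signs

/-! ### Vector-valued contraction for finite families. -/

section Contraction

theorem le_ciSup_of_finite {ι : Type*} [Finite ι] (g : ι → ℝ) (k : ι) : g k ≤ ⨆ k, g k :=
  le_ciSup (Set.finite_range g).bddAbove k

variable {ι : Type*} [Finite ι] [Nonempty ι]

/-- One sign is traded for `C` signs. At maximizers `k`, `k'` of the two suprema, Khintchine turns
the Lipschitz bound on `b k - b k'` into a mean of `|signSum τ (v k - v k')|`. For each `τ` this
absolute value is covered by the suprema at `τ` and `-τ`, which have the same mean. -/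
theorem contraction_single {C : ℕ} (A b : ι → ℝ) (v : ι → Fin C → ℝ) {c : ℝ} (hc : 0 ≤ c)
    (hb : ∀ k k', b k - b k' ≤ c * √(∑ y, (v k y - v k' y) ^ 2)) :
    ((⨆ k, (A k + b k)) + ⨆ k, (A k - b k)) / 2
      ≤ 𝔼 τ : Fin C → ℤˣ, ⨆ k, (A k + 2 * c * signSum τ (v k)) := by
  obtain ⟨k, hk⟩ := exists_eq_ciSup_of_finite (f := fun k => A k + b k)
  obtain ⟨k', hk'⟩ := exists_eq_ciSup_of_finite (f := fun k => A k - b k)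
  rw [← hk, ← hk']
  have h1 : b k - b k' ≤ 2 * c * 𝔼 τ : Fin C → ℤˣ, |signSum τ fun y => v k y - v k' y| :=
    (hb k k').trans (by
      have := mul_le_mul_of_nonneg_left
        (sqrt_sum_sq_le_expect_abs_signSum fun y => v k y - v k' y) hc
      linarith)
  have h2 : ∀ τ : Fin C → ℤˣ,
      A k + A k' + 2 * c * |signSum τ fun y => v k y - v k' y|
        ≤ (⨆ k, (A k + 2 * c * signSum τ (v k))) + ⨆ k, (A k + 2 * c * signSum (-τ) (v k)) := by
    intro τ
    have e1 := le_ciSup_of_finite (fun k => A k + 2 * c * signSum τ (v k))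
    have e2 := le_ciSup_of_finite (fun k => A k + 2 * c * signSum (-τ) (v k))
    simp only [signSum_neg] at e2 ⊢
    rw [signSum_sub]
    rcases abs_cases (signSum τ (v k) - signSum τ (v k')) with ⟨h, -⟩ | ⟨h, -⟩
    · have := e1 k; have := e2 k'; rw [h]; linarith
    · have := e1 k'; have := e2 k; rw [h]; linarith
  have h3 := Finset.expect_le_expect (s := univ) fun τ _ => h2 τ
  rw [expect_add_distrib, expect_add_distrib, expect_add_distrib, Fintype.expect_const,
    Fintype.expect_const, ← mul_expect,
    expect_neg_signs fun τ => ⨆ k, (A k + 2 * c * signSum τ (v k))] at h3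
  linarith

/-- The arbitrary offset `A` makes the induction on coordinates work: it absorbs the coordinates not
being treated, whether contracted or not. -/
theorem contraction_offset {C n : ℕ} (A : ι → ℝ) (b : ι → Fin n → ℝ) (v : ι → Fin n → Fin C → ℝ)
    {c : ℝ} (hc : 0 ≤ c)
    (hb : ∀ k k' i, b k i - b k' i ≤ c * √(∑ y, (v k i y - v k' i y) ^ 2)) :
    𝔼 σ : Fin n → ℤˣ, ⨆ k, (A k + signSum σ (b k))
      ≤ 𝔼 τ : Fin n → Fin C → ℤˣ, ⨆ k, (A k + 2 * c * ∑ i, signSum (τ i) (v k i)) := by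
  induction n generalizing A with
  | zero => simp [signSum]
  | succ n ih =>
    rw [expect_fin_succ_pi, expect_fin_succ_pi]
    simp only [signSum_cons, Fin.sum_univ_succ, Fin.cons_zero, Fin.cons_succ]
    calc _ = 𝔼 s : ℤˣ, 𝔼 σ : Fin n → ℤˣ,
          ⨆ k, ((A k + ((s : ℤ) : ℝ) * b k 0) + signSum σ (Fin.tail (b k))) := by
          simp only [add_assoc]
      _ ≤ 𝔼 s : ℤˣ, 𝔼 τ : Fin n → Fin C → ℤˣ, ⨆ k, ((A k + ((s : ℤ) : ℝ) * b k 0)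
          + 2 * c * ∑ i, signSum (τ i) (v k i.succ)) :=
          expect_le_expect fun s _ => ih (fun k => A k + ((s : ℤ) : ℝ) * b k 0)
            (fun k => Fin.tail (b k)) (fun k i => v k i.succ) fun k k' i => hb k k' i.succ
      _ = 𝔼 τ : Fin n → Fin C → ℤˣ, 𝔼 s : ℤˣ, ⨆ k, ((A k + ((s : ℤ) : ℝ) * b k 0)
          + 2 * c * ∑ i, signSum (τ i) (v k i.succ)) := expect_comm _ _ _
      _ ≤ 𝔼 τ : Fin n → Fin C → ℤˣ, 𝔼 t : Fin C → ℤˣ, ⨆ k,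
          ((A k + 2 * c * ∑ i, signSum (τ i) (v k i.succ)) + 2 * c * signSum t (v k 0)) := by
          refine expect_le_expect fun τ _ => ?_
          refine le_trans (le_of_eq ?_) (contraction_single
            (fun k => A k + 2 * c * ∑ i, signSum (τ i) (v k i.succ)) (fun k => b k 0)
            (fun k => v k 0) hc fun k k' => hb k k' 0)
          rw [expect_intUnits]
          congr 3 <;> funext k <;> simp <;> ring
      _ = 𝔼 t : Fin C → ℤˣ, 𝔼 τ : Fin n → Fin C → ℤˣ, ⨆ k,
          ((A k + 2 * c * ∑ i, signSum (τ i) (v k i.succ)) + 2 * c * signSum t (v k 0)) :=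
          expect_comm _ _ _
      _ = _ := by
          refine expect_congr rfl fun t _ => expect_congr rfl fun τ _ => ?_
          congr 1; funext k; ring

/-- Vector-valued contraction principle for Rademacher averages of a finite family. -/
theorem contraction {C n : ℕ} (b : ι → Fin n → ℝ) (v : ι → Fin n → Fin C → ℝ)
    {c : ℝ} (hc : 0 ≤ c)
    (hb : ∀ k k' i, b k i - b k' i ≤ c * √(∑ y, (v k i y - v k' i y) ^ 2)) :
    𝔼 σ : Fin n → ℤˣ, ⨆ k, signSum σ (b k)
      ≤ 2 * c * ∑ y, 𝔼 σ : Fin n → ℤˣ, ⨆ k, signSum σ fun i => v k i y := by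
  have h := contraction_offset (fun _ => 0) b v hc hb
  simp only [zero_add] at h
  refine h.trans ?_
  have h1 : ∀ τ : Fin n → Fin C → ℤˣ, ⨆ k, 2 * c * ∑ i, signSum (τ i) (v k i)
      ≤ 2 * c * ∑ y, ⨆ k, signSum (fun i => τ i y) fun i => v k i y := by
    intro τ
    refine ciSup_le fun k => mul_le_mul_of_nonneg_left ?_ (by positivity)
    simp only [signSum]
    rw [sum_comm]
    exact sum_le_sum fun y _ =>
      le_ciSup_of_finite (fun k => ∑ i, ((τ i y : ℤ) : ℝ) * v k i y) k
  refine (expect_le_expect fun τ _ => h1 τ).trans (le_of_eq ?_)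
  rw [← mul_expect, expect_sum_comm]
  congr 1
  refine sum_congr rfl fun y _ => ?_
  rw [← expect_pi_eval y fun σ : Fin n → ℤˣ => ⨆ k, signSum σ fun i => v k i y]
  exact Fintype.expect_equiv (Equiv.piComm _) _ _ fun _ => rfl

end Contraction

/-! ### Closure properties that settle all integrability questions for finite families. -/

section BoundedMeasurable

variable {α β : Type*} [MeasurableSpace α] [MeasurableSpace β]

/-- Measurable real functions with bounded values. -/
def BoundedMeasurable (f : α → ℝ) : Prop := Measurable f ∧ ∃ M, ∀ x, |f x| ≤ M

namespace BoundedMeasurable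

theorem const (c : ℝ) : BoundedMeasurable fun _ : α => c := ⟨measurable_const, |c|, fun _ => le_rfl⟩

theorem add {f g : α → ℝ} (hf : BoundedMeasurable f) (hg : BoundedMeasurable g) :
    BoundedMeasurable fun x => f x + g x := by
  obtain ⟨hf, M, hM⟩ := hf
  obtain ⟨hg, M', hM'⟩ := hg
  exact ⟨hf.add hg, M + M', fun x => (abs_add_le _ _).trans (add_le_add (hM x) (hM' x))⟩

theorem const_mul {f : α → ℝ} (hf : BoundedMeasurable f) (c : ℝ) :
    BoundedMeasurable fun x => c * f x := by
  obtain ⟨hf, M, hM⟩ := hf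
  exact ⟨hf.const_mul c, |c| * M, fun x => by
    rw [abs_mul]; exact mul_le_mul_of_nonneg_left (hM x) (abs_nonneg c)⟩

theorem neg {f : α → ℝ} (hf : BoundedMeasurable f) : BoundedMeasurable fun x => -f x := by
  simpa using hf.const_mul (-1)

theorem sub {f g : α → ℝ} (hf : BoundedMeasurable f) (hg : BoundedMeasurable g) :
    BoundedMeasurable fun x => f x - g x := by
  simpa [sub_eq_add_neg] using hf.add hg.neg

theorem abs {f : α → ℝ} (hf : BoundedMeasurable f) : BoundedMeasurable fun x => |f x| := by
  obtain ⟨hf, M, hM⟩ := hf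
  exact ⟨measurable_norm.comp hf, M, fun x => by rw [abs_abs]; exact hM x⟩

theorem exp {f : α → ℝ} (hf : BoundedMeasurable f) : BoundedMeasurable fun x => Real.exp (f x) := by
  obtain ⟨hf, M, hM⟩ := hf
  exact ⟨hf.exp, Real.exp M, fun x => by
    rw [abs_of_pos (Real.exp_pos _)]; exact Real.exp_le_exp.2 ((le_abs_self _).trans (hM x))⟩

theorem sum {κ : Type*} {s : Finset κ} {f : κ → α → ℝ} (hf : ∀ i, BoundedMeasurable (f i)) :
    BoundedMeasurable fun x => ∑ i ∈ s, f i x := by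
  classical
  induction s using Finset.induction_on with
  | empty => simpa using const 0
  | insert a s ha ih => simp only [sum_insert ha]; exact (hf a).add ih

theorem signSum {κ : Type*} [Fintype κ] (σ : κ → ℤˣ) {f : κ → α → ℝ}
    (hf : ∀ i, BoundedMeasurable (f i)) : BoundedMeasurable fun x => signSum σ fun i => f i x :=
  sum fun i => (hf i).const_mul _

theorem expect {κ : Type*} {s : Finset κ} {f : κ → α → ℝ} (hf : ∀ i, BoundedMeasurable (f i)) :
    BoundedMeasurable fun x => 𝔼 i ∈ s, f i x := by
  simp only [expect_eq_sum_div_card, div_eq_inv_mul]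
  exact (sum hf).const_mul _

theorem iSup {ι : Type*} [Finite ι] [Nonempty ι] {f : ι → α → ℝ}
    (hf : ∀ i, BoundedMeasurable (f i)) : BoundedMeasurable fun x => ⨆ i, f i x := by
  choose hm M hM using hf
  obtain ⟨B, hB⟩ := (Set.finite_range M).bddAbove
  refine ⟨Measurable.iSup hm, B, fun x => ?_⟩
  have hB' : ∀ i, |f i x| ≤ B := fun i => (hM i x).trans (hB ⟨i, rfl⟩)
  obtain ⟨i, hi⟩ := exists_eq_ciSup_of_finite (f := fun i => f i x)
  change |⨆ i, f i x| ≤ B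
  rw [← hi]
  exact hB' i

theorem comp {f : α → ℝ} (hf : BoundedMeasurable f) {u : β → α} (hu : Measurable u) :
    BoundedMeasurable fun x => f (u x) := by
  obtain ⟨hf, M, hM⟩ := hf
  exact ⟨hf.comp hu, M, fun x => hM _⟩

theorem integrable {f : α → ℝ} (hf : BoundedMeasurable f) {ν : Measure α} [IsFiniteMeasure ν] :
    Integrable f ν := by
  obtain ⟨hf, M, hM⟩ := hf
  exact Integrable.of_bound hf.aestronglyMeasurable M (ae_of_all _ hM)

theorem integral_right {f : α → β → ℝ} (hf : BoundedMeasurable fun p : α × β => f p.1 p.2)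
    (ν : Measure β) [IsProbabilityMeasure ν] : BoundedMeasurable fun x => ∫ y, f x y ∂ν := by
  obtain ⟨hf, M, hM⟩ := hf
  refine ⟨(hf.stronglyMeasurable.integral_prod_right (ν := ν)).measurable, M, fun x => ?_⟩
  have := norm_integral_le_of_norm_le_const (μ := ν) (f := f x) (ae_of_all _ fun y => hM (x, y))
  simpa using this

end BoundedMeasurable

end BoundedMeasurable

/-! ### Hoeffding's lemma and McDiarmid's inequality on product spaces. -/

section Product

variable {Z : Type*} [MeasurableSpace Z]

theorem measurable_fin_cons {n : ℕ} :
    Measurable fun p : Z × (Fin n → Z) => (Fin.cons p.1 p.2 : Fin (n + 1) → Z) := by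
  refine measurable_pi_iff.2 fun i => ?_
  refine Fin.cases ?_ (fun i => ?_) i
  · simpa using measurable_fst
  · simpa [Function.comp_def] using (measurable_pi_apply i).comp measurable_snd

theorem BoundedMeasurable.integral_fin_cons {n : ℕ} {f : (Fin (n + 1) → Z) → ℝ}
    (hf : BoundedMeasurable f) (π : Measure (Fin n → Z)) [IsProbabilityMeasure π] :
    BoundedMeasurable fun a => ∫ z, f (Fin.cons a z) ∂π :=
  (hf.comp measurable_fin_cons).integral_right (f := fun a z => f (Fin.cons a z)) π

variable (ν : Measure Z) [IsProbabilityMeasure ν]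

theorem integral_fin_succ_pi {n : ℕ} {f : (Fin (n + 1) → Z) → ℝ} (hf : BoundedMeasurable f) :
    ∫ z, f z ∂(Measure.pi fun _ => ν)
      = ∫ a, ∫ z, f (Fin.cons a z) ∂(Measure.pi fun _ : Fin n => ν) ∂ν := by
  have h := (measurePreserving_piFinSuccAbove (fun _ : Fin (n + 1) => ν) 0).symm
  rw [← h.integral_comp' f]
  have he : ∀ p : Z × (Fin n → Z),
      (MeasurableEquiv.piFinSuccAbove (fun _ : Fin (n + 1) => Z) 0).symm p = Fin.cons p.1 p.2 :=
    fun p => Fin.insertNth_zero' _ _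
  simp only [he]
  exact integral_prod _ (hf.comp measurable_fin_cons).integrable

/-- Hoeffding's lemma for a function of oscillation at most `c`. -/
theorem integral_exp_le_of_oscillation {g : Z → ℝ} (hg : Measurable g) {c : ℝ}
    (hc : ∀ z w, g z - g w ≤ c) (s : ℝ) :
    ∫ z, Real.exp (s * g z) ∂ν ≤ Real.exp (s * ∫ z, g z ∂ν + s ^ 2 * c ^ 2 / 8) := by
  obtain ⟨z₀⟩ := ν.nonempty_of_neZero
  have hbdd : BddBelow (Set.range g) := ⟨g z₀ - c, by rintro _ ⟨z, rfl⟩; linarith [hc z₀ z]⟩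
  -- The values lie in an interval of length `c` starting at the infimum, which gives variance proxy
  -- `c² / 4`.
  have hI : ∀ z, g z ∈ Set.Icc (⨅ z, g z) ((⨅ z, g z) + c) := fun z => by
    have : Nonempty Z := ⟨z₀⟩
    refine ⟨ciInf_le hbdd z, ?_⟩
    have : g z - c ≤ ⨅ z, g z := le_ciInf fun w => by linarith [hc z w]
    linarith
  have h := (hasSubgaussianMGF_of_mem_Icc (μ := ν) hg.aemeasurable (ae_of_all _ hI)).mgf_le s
  have hc2 : ((((‖(⨅ z, g z) + c - ⨅ z, g z‖₊ / 2) ^ 2 : ℝ≥0)) : ℝ) = c ^ 2 / 4 := by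
    push_cast
    rw [add_sub_cancel_left, Real.norm_eq_abs, div_pow, sq_abs]
    norm_num
  rw [hc2, mgf] at h
  have e1 : ∀ z, Real.exp (s * g z)
      = Real.exp (s * ∫ z, g z ∂ν) * Real.exp (s * (g z - ∫ z, g z ∂ν)) := fun z => by
    rw [← Real.exp_add]; ring_nf
  simp only [e1]
  rw [integral_const_mul, Real.exp_add]
  refine mul_le_mul_of_nonneg_left (h.trans (Real.exp_le_exp.2 (le_of_eq ?_))) (Real.exp_pos _).le
  ring

/-- McDiarmid's inequality, in the form of a bound on the moment generating function. -/
theorem integral_exp_le_of_bounded_differences {n : ℕ} {G : (Fin n → Z) → ℝ}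
    (hG : BoundedMeasurable G) {c : ℝ}
    (hc : ∀ i z w, (∀ j, j ≠ i → z j = w j) → G z - G w ≤ c) (s : ℝ) :
    ∫ z, Real.exp (s * G z) ∂(Measure.pi fun _ => ν)
      ≤ Real.exp (s * ∫ z, G z ∂(Measure.pi fun _ => ν) + n * (s ^ 2 * c ^ 2 / 8)) := by
  induction n with
  | zero => simp [integral_unique]
  | succ n ih =>
    have hG' : BoundedMeasurable fun p : Z × (Fin n → Z) => G (Fin.cons p.1 p.2) :=
      hG.comp measurable_fin_cons
    have hGa : ∀ a, BoundedMeasurable fun z : Fin n → Z => G (Fin.cons a z) :=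
      fun a => hG'.comp (measurable_const.prodMk measurable_id)
    set π := Measure.pi fun _ : Fin n => ν
    set k := s ^ 2 * c ^ 2 / 8 with hk
    have hg := hG'.integral_right (f := fun a z => G (Fin.cons a z)) π
    rw [integral_fin_succ_pi ν (hG.const_mul s).exp, integral_fin_succ_pi ν hG]
    have h1 : ∀ a, ∫ z, Real.exp (s * G (Fin.cons a z)) ∂π
        ≤ Real.exp (s * ∫ z, G (Fin.cons a z) ∂π + n * k) := fun a =>
      ih (hGa a) fun i z w h => hc i.succ _ _ fun j => by
        refine Fin.cases (fun _ => rfl) (fun j hj => ?_) j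
        simpa using h j fun e => hj (congrArg _ e)
    -- Integrating out the other coordinates preserves the oscillation in the first one, so
    -- Hoeffding's lemma contributes one more term `k`.
    have h2 : ∀ a b, ∫ z, G (Fin.cons a z) ∂π - ∫ z, G (Fin.cons b z) ∂π ≤ c := fun a b => by
      rw [← integral_sub (hGa a).integrable (hGa b).integrable]
      refine (integral_mono ((hGa a).sub (hGa b)).integrable (integrable_const c)
        fun z => hc 0 _ _ fun j => ?_).trans (by simp)
      refine Fin.cases (fun h => absurd rfl h) (fun j _ => by simp) j
    calc _ ≤ ∫ a, Real.exp (s * ∫ z, G (Fin.cons a z) ∂π + n * k) ∂ν :=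
          integral_mono (((hG'.const_mul s).exp).integral_right
            (f := fun a z => Real.exp (s * G (Fin.cons a z))) π).integrable
            ((hg.const_mul s).add (.const _)).exp.integrable h1
      _ = (∫ a, Real.exp (s * ∫ z, G (Fin.cons a z) ∂π) ∂ν) * Real.exp (n * k) := by
          simp only [Real.exp_add, integral_mul_const]
      _ ≤ Real.exp (s * ∫ a, ∫ z, G (Fin.cons a z) ∂π ∂ν + k) * Real.exp (n * k) :=
          mul_le_mul_of_nonneg_right (integral_exp_le_of_oscillation ν hg.1 h2 s)
            (Real.exp_pos _).le
      _ = _ := by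
          rw [← Real.exp_add]; push_cast; ring_nf; rfl

end Product

/-! ### Symmetrization and exponential moments of uniform deviations. -/

section Symmetrization

variable {Z : Type*} [MeasurableSpace Z] (ν : Measure Z) [IsProbabilityMeasure ν]
variable {ι : Type*} [Finite ι] [Nonempty ι]

/-- No ghost sample is needed: `A + (∫ g - g z)` is the average of `A + 2 ∫ g` and `A - 2 g z`. The
supremum is subadditive, and a supremum of integrals is at most the integral of the supremum. -/
theorem symmetrization_single (A : ι → ℝ) {g : ι → Z → ℝ} (hg : ∀ k, BoundedMeasurable (g k)) :
    ∫ z, (⨆ k, (A k + (∫ w, g k w ∂ν - g k z))) ∂ν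
      ≤ 𝔼 s : ℤˣ, ∫ z, (⨆ k, (A k + 2 * (((s : ℤ) : ℝ) * g k z))) ∂ν := by
  have hp : ∀ c : ℝ, BoundedMeasurable fun z => ⨆ k, (A k + 2 * (c * g k z)) := fun c =>
    .iSup fun k => (BoundedMeasurable.const _).add (((hg k).const_mul _).const_mul _)
  have hl : BoundedMeasurable fun z => ⨆ k, (A k + (∫ w, g k w ∂ν - g k z)) :=
    .iSup fun k => (BoundedMeasurable.const _).add ((BoundedMeasurable.const _).sub (hg k))
  have hpt : ∀ z, (⨆ k, (A k + (∫ w, g k w ∂ν - g k z)))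
      ≤ 1 / 2 * ∫ w, (⨆ k, (A k + 2 * (1 * g k w))) ∂ν
        + 1 / 2 * ⨆ k, (A k + 2 * (-1 * g k z)) := fun z => by
    refine ciSup_le fun k => ?_
    have h1 : A k + 2 * ∫ w, g k w ∂ν ≤ ∫ w, (⨆ k, (A k + 2 * (1 * g k w))) ∂ν := by
      have : A k + 2 * ∫ w, g k w ∂ν = ∫ w, (A k + 2 * (1 * g k w)) ∂ν := by
        rw [integral_add (integrable_const _) (((hg k).const_mul 1).const_mul 2).integrable,
          integral_const_mul]
        simp
      rw [this]
      exact integral_mono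
        ((BoundedMeasurable.const _).add (((hg k).const_mul 1).const_mul 2)).integrable
        (hp 1).integrable fun w => le_ciSup_of_finite (fun k => A k + 2 * (1 * g k w)) k
    have h2 := le_ciSup_of_finite (fun k => A k + 2 * (-1 * g k z)) k
    linarith
  have h := integral_mono (μ := ν) hl.integrable
    ((BoundedMeasurable.const _).add ((hp (-1)).const_mul (1 / 2))).integrable hpt
  rw [integral_add (integrable_const _) ((hp (-1)).const_mul (1 / 2)).integrable,
    integral_const_mul (1 / 2) fun z => ⨆ k, (A k + 2 * (-1 * g k z)), integral_const,
    probReal_univ, one_smul] at h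
  rw [expect_intUnits]
  push_cast
  linarith

theorem symmetrization_offset {n : ℕ} (A : ι → ℝ) {g : ι → Z → ℝ}
    (hg : ∀ k, BoundedMeasurable (g k)) :
    ∫ z, (⨆ k, (A k + ∑ i, (∫ w, g k w ∂ν - g k (z i)))) ∂(Measure.pi fun _ : Fin n => ν)
      ≤ 𝔼 σ : Fin n → ℤˣ, ∫ z, (⨆ k, (A k + 2 * signSum σ fun i => g k (z i)))
        ∂(Measure.pi fun _ : Fin n => ν) := by
  induction n generalizing A with
  | zero => simp [signSum]
  | succ n ih =>
    set π := Measure.pi fun _ : Fin n => ν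
    have hgi : ∀ (m : ℕ) k (i : Fin m), BoundedMeasurable fun z : Fin m → Z => g k (z i) :=
      fun m k i => (hg k).comp (measurable_pi_apply i)
    have hR : ∀ m (σ : Fin m → ℤˣ), BoundedMeasurable fun z : Fin m → Z =>
        ⨆ k, (A k + 2 * signSum σ fun i => g k (z i)) := fun m σ =>
      .iSup fun k => (BoundedMeasurable.const _).add
        ((BoundedMeasurable.signSum σ fun i => hgi m k i).const_mul 2)
    have hL : BoundedMeasurable fun z : Fin (n + 1) → Z =>
        ⨆ k, (A k + ∑ i, (∫ w, g k w ∂ν - g k (z i))) :=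
      .iSup fun k => (BoundedMeasurable.const _).add
        (.sum fun i => (BoundedMeasurable.const _).sub (hgi _ k i))
    have hM₀ : ∀ {β : Type _} [MeasurableSpace β] (σ : Fin n → ℤˣ) {u : β → Z}
        {w : β → Fin n → Z}, Measurable u → Measurable w → BoundedMeasurable fun x =>
        ⨆ k, ((A k + (∫ w, g k w ∂ν - g k (u x))) + 2 * signSum σ fun i => g k (w x i)) :=
      fun σ _ _ hu hw => .iSup fun k => ((BoundedMeasurable.const _).add
        ((BoundedMeasurable.const _).sub ((hg k).comp hu))).add
          ((BoundedMeasurable.signSum σ fun i => (hgi n k i).comp hw).const_mul 2)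
    have hM := fun σ => hM₀ (β := Z × (Fin n → Z)) σ measurable_fst measurable_snd
    have hMs := fun σ => hM₀ (β := (Fin n → Z) × Z) σ measurable_snd measurable_fst
    have hN : ∀ (σ : Fin n → ℤˣ) (s : ℤˣ), BoundedMeasurable fun p : (Fin n → Z) × Z =>
        ⨆ k, ((A k + 2 * signSum σ fun i => g k (p.1 i)) + 2 * (((s : ℤ) : ℝ) * g k p.2)) :=
      fun σ s => .iSup fun k => ((BoundedMeasurable.const _).add
          ((BoundedMeasurable.signSum σ fun i => (hgi n k i).comp measurable_fst).const_mul 2)).add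
          ((((hg k).comp measurable_snd).const_mul _).const_mul _)
    have hM' := fun σ : Fin n → ℤˣ => (hM σ).integral_right (f := fun (a : Z) (z : Fin n → Z) =>
        ⨆ k, ((A k + (∫ w, g k w ∂ν - g k a)) + 2 * signSum σ fun i => g k (z i))) π
    have hM'' := fun σ : Fin n → ℤˣ => (hMs σ).integral_right (f := fun (z : Fin n → Z) (a : Z) =>
        ⨆ k, ((A k + (∫ w, g k w ∂ν - g k a)) + 2 * signSum σ fun i => g k (z i))) ν
    have hN' := fun (σ : Fin n → ℤˣ) s => (hN σ s).integral_right (f := fun (z : Fin n → Z) (a : Z) =>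
        ⨆ k, ((A k + 2 * signSum σ fun i => g k (z i)) + 2 * (((s : ℤ) : ℝ) * g k a))) ν
    rw [integral_fin_succ_pi ν hL, expect_fin_succ_pi]
    have hL' := hL.integral_fin_cons π
    -- The induction hypothesis is used with the first coordinate's deviation in the offset. Fubini
    -- then makes that coordinate innermost, and `symmetrization_single` treats it with the already
    -- signed coordinates as offset.
    calc _ ≤ ∫ a, 𝔼 σ : Fin n → ℤˣ, ∫ z,
            (⨆ k, ((A k + (∫ w, g k w ∂ν - g k a)) + 2 * signSum σ fun i => g k (z i))) ∂π ∂ν := by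
          refine integral_mono hL'.integrable (BoundedMeasurable.expect hM').integrable fun a => ?_
          refine le_trans (le_of_eq ?_) (ih fun k => A k + (∫ w, g k w ∂ν - g k a))
          simp only [Fin.sum_univ_succ, Fin.cons_zero, Fin.cons_succ, add_assoc]
          rfl
      _ = 𝔼 σ : Fin n → ℤˣ, ∫ z, ∫ a,
            (⨆ k, ((A k + (∫ w, g k w ∂ν - g k a)) + 2 * signSum σ fun i => g k (z i))) ∂ν ∂π := by
          simp only [expect_eq_sum_div_card]
          rw [integral_div, integral_finsetSum _ fun σ _ => (hM' σ).integrable]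
          congr 1
          refine sum_congr rfl fun σ _ => ?_
          exact integral_integral_swap (hM σ).integrable
      _ ≤ 𝔼 σ : Fin n → ℤˣ, ∫ z, 𝔼 s : ℤˣ, ∫ a,
            (⨆ k, ((A k + 2 * signSum σ fun i => g k (z i)) + 2 * (((s : ℤ) : ℝ) * g k a)))
              ∂ν ∂π := by
          refine expect_le_expect fun σ _ => integral_mono (hM'' σ).integrable
            (BoundedMeasurable.expect (hN' σ)).integrable fun z => ?_
          refine le_trans (le_of_eq ?_)
            (symmetrization_single ν (fun k => A k + 2 * signSum σ fun i => g k (z i)) hg)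
          congr 1; funext a; congr 1; funext k; ring
      _ = 𝔼 s : ℤˣ, 𝔼 σ : Fin n → ℤˣ, ∫ z, ∫ a,
            (⨆ k, ((A k + 2 * signSum σ fun i => g k (z i)) + 2 * (((s : ℤ) : ℝ) * g k a)))
              ∂ν ∂π := by
          rw [expect_comm]
          refine expect_congr rfl fun σ _ => ?_
          simp only [expect_eq_sum_div_card]
          rw [integral_div, integral_finsetSum _ fun s _ => (hN' σ s).integrable]
      _ = _ := by
          refine expect_congr rfl fun s _ => expect_congr rfl fun σ _ => ?_
          rw [integral_integral_swap (hN σ s).integrable, integral_fin_succ_pi ν (hR _ _)]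
          congr 1; funext a; congr 1; funext z; congr 1; funext k
          rw [signSum_cons]
          simp [Fin.tail_def]
          ring

/-- Replacing one sample point moves each sum, hence the supremum, by at most `c`, so McDiarmid
applies; symmetrization bounds the mean. -/
theorem integral_exp_iSup_deviation_le {n : ℕ} {g : ι → Z → ℝ}
    (hg : ∀ k, BoundedMeasurable (g k)) {c : ℝ} (hc : ∀ k z w, g k z - g k w ≤ c) {s : ℝ}
    (hs : 0 ≤ s) :
    ∫ z, Real.exp (s * ⨆ k, ∑ i, (∫ w, g k w ∂ν - g k (z i))) ∂(Measure.pi fun _ : Fin n => ν)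
      ≤ Real.exp (s * (2 * ∫ z, (𝔼 σ : Fin n → ℤˣ, ⨆ k, signSum σ fun i => g k (z i))
          ∂(Measure.pi fun _ : Fin n => ν)) + n * (s ^ 2 * c ^ 2 / 8)) := by
  have hgi : ∀ k (i : Fin n), BoundedMeasurable fun z : Fin n → Z => g k (z i) :=
    fun k i => (hg k).comp (measurable_pi_apply i)
  have hL : BoundedMeasurable fun z : Fin n → Z => ⨆ k, ∑ i, (∫ w, g k w ∂ν - g k (z i)) :=
    .iSup fun k => .sum fun i => (BoundedMeasurable.const _).sub (hgi k i)
  refine (integral_exp_le_of_bounded_differences ν hL (c := c) ?_ s).trans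
    (Real.exp_le_exp.2 (add_le_add_left (mul_le_mul_of_nonneg_left ?_ hs) _))
  · intro i z w h
    rw [sub_le_iff_le_add]
    refine ciSup_le fun k => ?_
    have h1 := le_ciSup_of_finite (fun k => ∑ i, (∫ w, g k w ∂ν - g k (w i))) k
    have h2 : ∑ j, (∫ w, g k w ∂ν - g k (z j)) - ∑ j, (∫ w, g k w ∂ν - g k (w j))
        = g k (w i) - g k (z i) := by
      rw [← sum_sub_distrib, Finset.sum_eq_single i]
      · ring
      · intro j _ hj; rw [h j hj]; ring
      · simp
    have h3 := hc k (w i) (z i)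
    linarith
  · have h := symmetrization_offset ν (n := n) (fun _ => 0) hg
    simp only [zero_add] at h
    refine h.trans (le_of_eq ?_)
    simp only [expect_eq_sum_div_card, ← Real.mul_iSup_of_nonneg zero_le_two]
    rw [integral_div, integral_finsetSum _ fun σ _ =>
      (BoundedMeasurable.iSup fun k => BoundedMeasurable.signSum σ fun i => hgi k i).integrable]
    simp only [integral_const_mul, ← Finset.mul_sum]
    ring

/-- Exponential moment of the uniform deviation between true and empirical means. -/
theorem integral_exp_iSup_abs_deviation_le {n : ℕ} {g : ι → Z → ℝ}
    (hg : ∀ k, BoundedMeasurable (g k)) {c : ℝ} (hc : ∀ k z w, g k z - g k w ≤ c) {s : ℝ}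
    (hs : 0 ≤ s) :
    ∫ z, Real.exp (s * ⨆ k, |∑ i, (∫ w, g k w ∂ν - g k (z i))|) ∂(Measure.pi fun _ : Fin n => ν)
      ≤ 2 * Real.exp (s * (2 * ∫ z, (𝔼 σ : Fin n → ℤˣ, ⨆ k, signSum σ fun i => g k (z i))
          ∂(Measure.pi fun _ : Fin n => ν)) + n * (s ^ 2 * c ^ 2 / 8)) := by
  have hd : ∀ k, BoundedMeasurable fun z : Fin n → Z => ∑ i, (∫ w, g k w ∂ν - g k (z i)) :=
    fun k => .sum fun i => (BoundedMeasurable.const _).sub ((hg k).comp (measurable_pi_apply i))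
  have hp := integral_exp_iSup_deviation_le ν (n := n) hg hc hs
  have hm := integral_exp_iSup_deviation_le ν (n := n) (fun k => (hg k).neg) (c := c)
    (fun k z w => by linarith [hc k w z]) hs
  -- The family `-g` has the same Rademacher average because `σ` and `-σ` have the same law. Both
  -- one-sided deviations thus obey one bound, and adding them produces the factor `2`.
  have e1 : ∀ z : Fin n → Z, (𝔼 σ : Fin n → ℤˣ, ⨆ k, signSum σ fun i => -g k (z i))
      = 𝔼 σ : Fin n → ℤˣ, ⨆ k, signSum σ fun i => g k (z i) := fun z => by
    simp only [signSum_neg_right, ← signSum_neg]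
    exact expect_neg_signs fun σ : Fin n → ℤˣ => ⨆ k, signSum σ fun i => g k (z i)
  have e2 : ∀ k (z : Fin n → Z), ∑ i, (∫ w, -g k w ∂ν - -g k (z i))
      = -∑ i, (∫ w, g k w ∂ν - g k (z i)) := fun k z => by
    rw [integral_neg, ← Finset.sum_neg_distrib]
    exact sum_congr rfl fun i _ => by ring
  simp only [e1, e2] at hm
  have hpt : ∀ z : Fin n → Z, Real.exp (s * ⨆ k, |∑ i, (∫ w, g k w ∂ν - g k (z i))|)
      ≤ Real.exp (s * ⨆ k, ∑ i, (∫ w, g k w ∂ν - g k (z i)))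
        + Real.exp (s * ⨆ k, -∑ i, (∫ w, g k w ∂ν - g k (z i))) := fun z => by
    obtain ⟨k, hk⟩ := exists_eq_ciSup_of_finite
      (f := fun k => |∑ i, (∫ w, g k w ∂ν - g k (z i))|)
    rw [← hk]
    rcases abs_cases (∑ i, (∫ w, g k w ∂ν - g k (z i))) with ⟨h, -⟩ | ⟨h, -⟩
    · rw [h]
      refine le_add_of_le_of_nonneg (Real.exp_le_exp.2 (mul_le_mul_of_nonneg_left ?_ hs))
        (Real.exp_pos _).le
      exact le_ciSup_of_finite (fun k => ∑ i, (∫ w, g k w ∂ν - g k (z i))) k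
    · rw [h]
      refine le_add_of_nonneg_of_le (Real.exp_pos _).le
        (Real.exp_le_exp.2 (mul_le_mul_of_nonneg_left ?_ hs))
      exact le_ciSup_of_finite (fun k => -∑ i, (∫ w, g k w ∂ν - g k (z i))) k
  have b1 := ((BoundedMeasurable.iSup hd).const_mul s).exp
  have b2 := ((BoundedMeasurable.iSup fun k => (hd k).neg).const_mul s).exp
  have b3 := ((BoundedMeasurable.iSup fun k => (hd k).abs).const_mul s).exp
  have h := integral_mono (μ := Measure.pi fun _ : Fin n => ν) b3.integrable
    (b1.add b2).integrable hpt
  rw [integral_add b1.integrable b2.integrable] at h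
  linarith

end Symmetrization

/-! ### Finite subfamilies against the complexity of the class. -/

section RademacherComplexity

variable {X : Type*} [MeasurableSpace X]

theorem ereal_coe_sum {κ : Type*} (s : Finset κ) (f : κ → ℝ) :
    ((∑ i ∈ s, f i : ℝ) : EReal) = ∑ i ∈ s, (f i : EReal) := by
  classical
  induction s using Finset.induction_on with
  | empty => simp
  | insert a s ha ih => rw [sum_insert ha, sum_insert ha, EReal.coe_add, ih]

theorem expect_iSup_signSum_nonneg {ι : Type*} [Finite ι] [Nonempty ι] {n : ℕ}
    (v : ι → Fin n → ℝ) : 0 ≤ 𝔼 σ : Fin n → ℤˣ, ⨆ k, signSum σ (v k) := by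
  obtain ⟨k⟩ := ‹Nonempty ι›
  rw [← expect_signSum (v k)]
  exact expect_le_expect fun σ _ => le_ciSup_of_finite (fun k => signSum σ (v k)) k

theorem measurable_expect_iSup_signSum {ι : Type*} [Finite ι] {n : ℕ} {h : ι → X → ℝ}
    (hh : ∀ k, Measurable (h k)) :
    Measurable fun x : Fin n → X => 𝔼 σ : Fin n → ℤˣ, ⨆ k, signSum σ fun i => h k (x i) := by
  simp only [expect_eq_sum_div_card, signSum]
  refine Measurable.div_const (Finset.measurable_sum _ fun σ _ => Measurable.iSup fun k =>
    Finset.measurable_sum _ fun i _ => Measurable.const_mul ?_ _) _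
  exact (hh k).comp (measurable_pi_apply i)

/-- The mean Rademacher average of a finite subfamily is at most `n` times the complexity of the
class. -/
theorem lintegral_expect_iSup_signSum_le {ι : Type*} [Finite ι] [Nonempty ι] (ν : Measure X)
    {n : ℕ} (hn : 0 < n) {H : Set (X → ℝ)} {h : ι → X → ℝ} (hH : ∀ k, h k ∈ H) :
    ∫⁻ x : Fin n → X, ENNReal.ofReal (𝔼 σ : Fin n → ℤˣ, ⨆ k, signSum σ fun i => h k (x i))
      ∂(Measure.pi fun _ => ν) ≤ n * rademacher ν n H := by
  rw [rademacher, ← lintegral_const_mul' _ _ (ENNReal.natCast_ne_top n)]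
  refine lintegral_mono fun x => ?_
  have hn' : (0 : ℝ) < n := by exact_mod_cast hn
  have h1 : (((∑ σ : Fin n → ℤˣ, (⨆ k, signSum σ fun i => h k (x i)) / n : ℝ)) : EReal)
      ≤ ∑ σ : Fin n → ℤˣ,
        ⨆ h ∈ H, (((∑ i, ((σ i : ℤ) : ℝ) * h (x i)) / n : ℝ) : EReal) := by
    rw [ereal_coe_sum]
    refine sum_le_sum fun σ _ => ?_
    obtain ⟨k, hk⟩ := exists_eq_ciSup_of_finite (f := fun k => signSum σ fun i => h k (x i))
    rw [← hk]
    exact le_iSup₂_of_le (h k) (hH k) le_rfl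
  have h2 := EReal.toENNReal_le_toENNReal h1
  rw [EReal.real_coe_toENNReal] at h2
  refine le_trans (le_of_eq ?_) (mul_le_mul_right (ENNReal.div_le_div_right h2 (2 ^ n)) (n : ℝ≥0∞))
  rw [← Finset.sum_div, Fintype.expect_eq_sum_div_card, Fintype.card_fun, Fintype.card_units_int,
    Fintype.card_fin]
  have h2n : (2 : ℝ≥0∞) ^ n = ENNReal.ofReal (2 ^ n) := by
    rw [ENNReal.ofReal_pow zero_le_two]; simp
  rw [h2n, ← ENNReal.ofReal_div_of_pos (by positivity), ← ENNReal.ofReal_natCast n,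
    ← ENNReal.ofReal_mul hn'.le]
  congr 1
  push_cast
  field_simp

end RademacherComplexity

/-! ### Deviation of a regular loss over finitely many models. -/

section Loss

variable {X : Type*} {C : ℕ}

/-- A loss which is measurable, and on the outputs of the class `F` Lipschitz with values in
`[0, U]`. -/
structure IsRegularLoss (l : Output C → Fin C → ℝ) (F : Set (X → Output C)) (ρ : ℝ≥0) (U : ℝ) :
    Prop where
  measurable : ∀ y, Measurable fun u => l u y
  nonneg : ∀ u y, 0 ≤ l u y
  le_bound : ∀ y, ∀ u ∈ outputs F, l u y ≤ U
  lipschitz : ∀ y, LipschitzOnWith ρ (fun u => l u y) (outputs F)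

namespace IsRegularLoss

variable {l : Output C → Fin C → ℝ} {F : Set (X → Output C)} {ρ : ℝ≥0} {U : ℝ}

theorem comp_mem_Icc (hl : IsRegularLoss l F ρ U) {f : X → Output C} (hf : f ∈ F)
    (p : X × Fin C) : l (f p.1) p.2 ∈ Set.Icc 0 U :=
  ⟨hl.nonneg _ _, hl.le_bound _ _ ⟨f, hf, p.1, rfl⟩⟩

variable [MeasurableSpace X]

theorem boundedMeasurable_comp (hl : IsRegularLoss l F ρ U) {f : X → Output C} (hf : f ∈ F)
    (hfm : Measurable f) : BoundedMeasurable fun p : X × Fin C => l (f p.1) p.2 :=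
  ⟨measurable_from_prod_countable_left fun y => (hl.measurable y).comp hfm, U, fun p => by
    have := hl.comp_mem_Icc hf p
    rw [abs_of_nonneg this.1]; exact this.2⟩

/-- Contraction is applied at each fixed sample, where the label merely selects which `ρ`-Lipschitz
function acts on each point. The labels then disappear and the sample can be pushed forward to `X`.
-/
theorem integral_expect_iSup_signSum_le (hl : IsRegularLoss l F ρ U) {ι : Type*} [Finite ι]
    [Nonempty ι] {a : ι → X → Output C} (ha : ∀ k, a k ∈ F) (ham : ∀ k, Measurable (a k))
    (D : Measure (X × Fin C)) [IsProbabilityMeasure D] {n : ℕ} (hn : 0 < n) :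
    ENNReal.ofReal (∫ z, (𝔼 σ : Fin n → ℤˣ, ⨆ k, signSum σ fun i => l (a k (z i).1) (z i).2)
        ∂(Measure.pi fun _ : Fin n => D))
      ≤ n * (ENNReal.ofReal (2 * ρ) *
        ∑ y, rademacher (D.map Prod.fst) n (classOutputs F y)) := by
  have hg := fun k => hl.boundedMeasurable_comp (ha k) (ham k)
  have hb : BoundedMeasurable fun z : Fin n → X × Fin C =>
      𝔼 σ : Fin n → ℤˣ, ⨆ k, signSum σ fun i => l (a k (z i).1) (z i).2 :=
    .expect fun σ => .iSup fun k => .signSum σ fun i => (hg k).comp (measurable_pi_apply i)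
  have hcoord : ∀ k y, Measurable fun x => a k x y := fun k y =>
    (by fun_prop : Measurable fun u : Output C => u y).comp (ham k)
  rw [ofReal_integral_eq_lintegral_ofReal hb.integrable
    (ae_of_all _ fun z => expect_iSup_signSum_nonneg _)]
  have hmeas : ∀ y, Measurable fun x : Fin n → X =>
      ENNReal.ofReal (𝔼 σ : Fin n → ℤˣ, ⨆ k, signSum σ fun i => a k (x i) y) := fun y =>
    (measurable_expect_iSup_signSum fun k => hcoord k y).ennreal_ofReal
  have hfst : Measurable fun (z : Fin n → X × Fin C) i => (z i).1 :=
    measurable_pi_iff.2 fun i => measurable_fst.comp (measurable_pi_apply i)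
  have hmeas' : ∀ y, Measurable fun z : Fin n → X × Fin C =>
      ENNReal.ofReal (𝔼 σ : Fin n → ℤˣ, ⨆ k, signSum σ fun i => a k (z i).1 y) := fun y =>
    (hmeas y).comp hfst
  have hD : IsProbabilityMeasure (D.map Prod.fst) :=
    Measure.isProbabilityMeasure_map measurable_fst.aemeasurable
  calc _ ≤ ∫⁻ z : Fin n → X × Fin C, ENNReal.ofReal (2 * ρ) * ∑ y, ENNReal.ofReal
          (𝔼 σ : Fin n → ℤˣ, ⨆ k, signSum σ fun i => a k (z i).1 y) ∂(Measure.pi fun _ => D) := by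
        refine lintegral_mono fun z => ?_
        rw [← ENNReal.ofReal_sum_of_nonneg fun y _ => expect_iSup_signSum_nonneg _,
          ← ENNReal.ofReal_mul (by positivity)]
        refine ENNReal.ofReal_le_ofReal (contraction _ _ ρ.2 fun k k' i => ?_)
        have h := (hl.lipschitz (z i).2).dist_le_mul (a k (z i).1) ⟨_, ha k, _, rfl⟩
          (a k' (z i).1) ⟨_, ha k', _, rfl⟩
        rw [EuclideanSpace.dist_eq, Real.dist_eq] at h
        simp only [Real.dist_eq, sq_abs] at h
        exact (le_abs_self _).trans h
    _ = ENNReal.ofReal (2 * ρ) * ∑ y, ∫⁻ x : Fin n → X, ENNReal.ofReal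
          (𝔼 σ : Fin n → ℤˣ, ⨆ k, signSum σ fun i => a k (x i) y)
            ∂(Measure.pi fun _ => D.map Prod.fst) := by
        rw [lintegral_const_mul' _ _ ENNReal.ofReal_ne_top,
          lintegral_finsetSum _ fun y _ => hmeas' y]
        congr 1
        refine sum_congr rfl fun y _ => ?_
        rw [← Measure.pi_map_pi (μ := fun _ : Fin n => D) (f := fun _ => Prod.fst)
          fun _ => measurable_fst.aemeasurable, lintegral_map (hmeas y) hfst]
    _ ≤ ENNReal.ofReal (2 * ρ) * ∑ y, n * rademacher (D.map Prod.fst) n (classOutputs F y) := by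
        refine mul_le_mul_right (sum_le_sum fun y _ => ?_) _
        exact lintegral_expect_iSup_signSum_le (h := fun k x => a k x y) _ hn
          fun k => ⟨a k, ha k, rfl⟩
    _ = _ := by rw [← Finset.mul_sum, mul_left_comm]

theorem boundedMeasurable_sampleImpact (hl : IsRegularLoss l F ρ U) {f : X → Output C} (hf : f ∈ F)
    (hfm : Measurable f) (D : Measure (X × Fin C)) {κ : Type*} [Fintype κ] :
    BoundedMeasurable fun z : κ → X × Fin C => sampleImpact D l z f := by
  refine ((BoundedMeasurable.const _).sub ?_).abs
  simp only [empRisk, div_eq_inv_mul]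
  exact (BoundedMeasurable.sum fun i => (hl.boundedMeasurable_comp hf hfm).comp
    (measurable_pi_apply i)).const_mul _

theorem sampleImpact_eq (D : Measure (X × Fin C)) {n : ℕ} (hn : 0 < n) (z : Fin n → X × Fin C)
    (f : X → Output C) : sampleImpact D l z f
      = (n : ℝ)⁻¹ * |∑ i, (∫ w, l (f w.1) w.2 ∂D - l (f (z i).1) (z i).2)| := by
  have hn' : (0 : ℝ) < n := by exact_mod_cast hn
  rw [sampleImpact, trueRisk, empRisk, ← abs_of_pos (inv_pos.2 hn'), ← abs_mul,
    sum_sub_distrib]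
  congr 1
  simp only [sum_const, card_univ, Fintype.card_fin, nsmul_eq_mul]
  field_simp

/-- Exponential moment of the largest deviation between true and empirical risk over a finite
family of models. -/
theorem integral_exp_iSup_sampleImpact_le (hl : IsRegularLoss l F ρ U) {ι : Type*} [Finite ι]
    [Nonempty ι] {a : ι → X → Output C} (ha : ∀ k, a k ∈ F) (ham : ∀ k, Measurable (a k))
    (D : Measure (X × Fin C)) [IsProbabilityMeasure D] {n : ℕ} (hn : 0 < n) {B : ℝ} (hB : 0 ≤ B)
    (hR : ENNReal.ofReal (4 * ρ) * ∑ y, rademacher (D.map Prod.fst) n (classOutputs F y)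
      ≤ ENNReal.ofReal B) {s : ℝ} (hs : 0 ≤ s) :
    ∫ z, Real.exp (s * ⨆ k, sampleImpact D l z (a k)) ∂(Measure.pi fun _ : Fin n => D)
      ≤ 2 * Real.exp (s * B + s ^ 2 * (U / (2 * √n)) ^ 2 / 2) := by
  have hn' : (0 : ℝ) < n := by exact_mod_cast hn
  have hg := fun k => hl.boundedMeasurable_comp (ha k) (ham k)
  -- The parameter `s / n` accounts for empirical means in place of sums: `n (s/n)² U² / 8 = s² (U /
  -- (2√n))² / 2`.
  have h := integral_exp_iSup_abs_deviation_le D (n := n) hg (c := U) (fun k z w => by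
    have h1 := (hl.comp_mem_Icc (ha k) z).2
    have h2 := (hl.comp_mem_Icc (ha k) w).1
    linarith) (s := s * (n : ℝ)⁻¹) (by positivity)
  simp only [sampleImpact_eq D hn, ← Real.mul_iSup_of_nonneg (inv_pos.2 hn').le, ← mul_assoc]
  simp only [← mul_assoc] at h
  refine h.trans (mul_le_mul_of_nonneg_left (Real.exp_le_exp.2 (add_le_add ?_ (le_of_eq ?_)))
    zero_le_two)
  · have h1 := hl.integral_expect_iSup_signSum_le ha ham D hn
    have h2 : ENNReal.ofReal (2 * ∫ z, (𝔼 σ : Fin n → ℤˣ, ⨆ k,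
        signSum σ fun i => l (a k (z i).1) (z i).2) ∂(Measure.pi fun _ : Fin n => D))
        ≤ ENNReal.ofReal (n * B) := by
      rw [ENNReal.ofReal_mul zero_le_two, ENNReal.ofReal_mul hn'.le, ENNReal.ofReal_natCast]
      calc _ ≤ ENNReal.ofReal 2 * (n * (ENNReal.ofReal (2 * ρ) *
            ∑ y, rademacher (D.map Prod.fst) n (classOutputs F y))) := by gcongr
        _ = n * (ENNReal.ofReal (4 * ρ) *
            ∑ y, rademacher (D.map Prod.fst) n (classOutputs F y)) := by
          rw [show ENNReal.ofReal (4 * ρ) = ENNReal.ofReal 2 * ENNReal.ofReal (2 * ρ) by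
            rw [← ENNReal.ofReal_mul zero_le_two]; ring_nf]
          ring
        _ ≤ _ := by gcongr
    rw [ENNReal.ofReal_le_ofReal_iff (by positivity)] at h2
    have h3 := mul_le_mul_of_nonneg_left h2 (show 0 ≤ s * (n : ℝ)⁻¹ by positivity)
    refine (le_of_eq ?_).trans (h3.trans (le_of_eq ?_))
    · ring
    · field_simp
  · rw [div_pow, mul_pow, mul_pow, Real.sq_sqrt hn'.le]
    field_simp
    norm_num

end IsRegularLoss

end Loss

/-! ### Tail bound for a sum of dependent variables. -/

section Chernoff

/-- A tail bound for a sum of arbitrarily dependent variables with sub-Gaussian exponential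
moments. -/
theorem measureReal_sum_ge_le {Ω : Type*} [MeasurableSpace Ω] (μ : Measure Ω)
    [IsProbabilityMeasure μ] {κ : Type*} {I : Finset κ} (hI : I.Nonempty) {G : κ → Ω → ℝ}
    (hG : ∀ t, BoundedMeasurable (G t)) {B τ : κ → ℝ} (hτ : ∀ t, 0 < τ t)
    (hexp : ∀ t ∈ I, ∀ s, 0 ≤ s →
      ∫ ω, Real.exp (s * G t ω) ∂μ ≤ 2 * Real.exp (s * B t + s ^ 2 * τ t ^ 2 / 2))
    {υ : ℝ} (hυ : 0 < υ) (hυ2 : υ ≤ 2) :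
    μ.real {ω | ∑ t ∈ I, B t + (∑ t ∈ I, τ t) * √(2 * Real.log (2 / υ)) ≤ ∑ t ∈ I, G t ω} ≤ υ := by
  set τs := ∑ t ∈ I, τ t with hτs
  set q := √(2 * Real.log (2 / υ)) with hq
  have hτp : 0 < τs := sum_pos (fun t _ => hτ t) hI
  have hq0 : 0 ≤ q := Real.sqrt_nonneg _
  have hlog : 0 ≤ Real.log (2 / υ) := Real.log_nonneg (by rwa [one_le_div hυ])
  have hq2 : q ^ 2 = 2 * Real.log (2 / υ) := Real.sq_sqrt (by positivity)
  -- This minimizes the Chernoff exponent `-s τs q + s² τs² / 2`, with value `-q² / 2 = -log (2 /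
  -- υ)`.
  set s := q / τs with hs
  have hs0 : 0 ≤ s := by positivity
  have hX : BoundedMeasurable fun ω => ∑ t ∈ I, G t ω := .sum hG
  have hm : mgf (fun ω => ∑ t ∈ I, G t ω) μ s
      ≤ 2 * Real.exp (s * ∑ t ∈ I, B t + s ^ 2 * τs ^ 2 / 2) := by
    -- Jensen's inequality with weights `τ t / τs` stands in for independence. The parameter `s τs /
    -- τ t` given to `G t` makes every summand have the same bound `2 exp (s ∑ B + s² τs² / 2)`.
    have hpt : ∀ ω, Real.exp (s * ∑ t ∈ I, G t ω) ≤ ∑ t ∈ I, (τ t / τs)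
        * (Real.exp (s * ∑ t ∈ I, B t - s * τs / τ t * B t)
          * Real.exp ((s * τs / τ t) * G t ω)) := fun ω => by
      have h := convexOn_exp.map_sum_le (t := I) (w := fun t => τ t / τs)
        (p := fun t => s * ∑ t ∈ I, B t - s * τs / τ t * B t + (s * τs / τ t) * G t ω)
        (fun t _ => div_nonneg (hτ t).le hτp.le)
        (by rw [← Finset.sum_div, div_self hτp.ne']) (fun _ _ => Set.mem_univ _)
      simp only [smul_eq_mul, Real.exp_add] at h
      refine le_trans (le_of_eq ?_) h
      congr 1
      have e : ∀ t, τ t / τs * (s * ∑ t ∈ I, B t - s * τs / τ t * B t + (s * τs / τ t) * G t ω)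
          = τ t * (s * (∑ t ∈ I, B t) / τs) - s * B t + s * G t ω := fun t => by
        have := (hτ t).ne'
        field_simp
      simp only [e]
      rw [sum_add_distrib, sum_sub_distrib, ← Finset.sum_mul, ← Finset.mul_sum, ← Finset.mul_sum,
        ← hτs]
      field_simp
      ring
    have hb : ∀ t, BoundedMeasurable fun ω => (τ t / τs)
        * (Real.exp (s * ∑ t ∈ I, B t - s * τs / τ t * B t)
          * Real.exp ((s * τs / τ t) * G t ω)) := fun t =>
      (((hG t).const_mul _).exp.const_mul _).const_mul _
    calc mgf (fun ω => ∑ t ∈ I, G t ω) μ s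
        ≤ ∫ ω, ∑ t ∈ I, (τ t / τs) * (Real.exp (s * ∑ t ∈ I, B t - s * τs / τ t * B t)
          * Real.exp ((s * τs / τ t) * G t ω)) ∂μ :=
          integral_mono (hX.const_mul s).exp.integrable (BoundedMeasurable.sum hb).integrable hpt
      _ = ∑ t ∈ I, (τ t / τs) * (Real.exp (s * ∑ t ∈ I, B t - s * τs / τ t * B t)
          * ∫ ω, Real.exp ((s * τs / τ t) * G t ω) ∂μ) := by
          rw [integral_finsetSum _ fun t _ => (hb t).integrable]
          simp only [integral_const_mul]
      _ ≤ ∑ t ∈ I, (τ t / τs) * (2 * Real.exp (s * ∑ t ∈ I, B t + s ^ 2 * τs ^ 2 / 2)) := by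
          refine sum_le_sum fun t ht =>
            mul_le_mul_of_nonneg_left ?_ (div_nonneg (hτ t).le hτp.le)
          have hst : 0 ≤ s * τs / τ t := div_nonneg (by positivity) (hτ t).le
          refine (mul_le_mul_of_nonneg_left (hexp t ht _ hst) (Real.exp_pos _).le).trans
            (le_of_eq ?_)
          rw [mul_left_comm, ← Real.exp_add]
          congr 2
          have := (hτ t).ne'
          field_simp
          ring
      _ = _ := by rw [← Finset.sum_mul, ← Finset.sum_div, div_self hτp.ne', one_mul]
  refine (measure_ge_le_exp_mul_mgf _ hs0 (hX.const_mul s).exp.integrable).trans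
    ((mul_le_mul_of_nonneg_left hm (Real.exp_pos _).le).trans (le_of_eq ?_))
  rw [mul_left_comm, ← Real.exp_add,
    show -s * (∑ t ∈ I, B t + τs * q) + (s * ∑ t ∈ I, B t + s ^ 2 * τs ^ 2 / 2)
      = -Real.log (2 / υ) by
        rw [hs]; field_simp; nlinarith,
    Real.exp_neg, Real.exp_log (by positivity)]
  field_simp

end Chernoff

/-! ### From finite families to the whole separable class. -/

section UniformDeviation

variable {X : Type*} [MeasurableSpace X] {C : ℕ}

theorem sampleImpact_comp_equiv (D : Measure (X × Fin C)) (l : Output C → Fin C → ℝ)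
    {κ κ' : Type*} [Fintype κ] [Fintype κ'] (e : κ' ≃ κ) (z : κ → X × Fin C) (f : X → Output C) :
    sampleImpact D l (fun i => z (e i)) f = sampleImpact D l z f := by
  simp only [sampleImpact, empRisk]
  rw [Equiv.sum_comp e fun i => l (f (z i).1) (z i).2, Fintype.card_congr e]

namespace IsRegularLoss

variable {l : Output C → Fin C → ℝ} {F : Set (X → Output C)} {ρ : ℝ≥0} {U : ℝ}

/-- The loss is continuous only on `outputs F`, so the limit is taken within that set; the constant
`U` dominates for the true risk. -/
theorem tendsto_sampleImpact (hl : IsRegularLoss l F ρ U) (hF : ∀ f ∈ F, Measurable f)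
    (D : Measure (X × Fin C)) [IsProbabilityMeasure D] {κ : Type*} [Fintype κ]
    (z : κ → X × Fin C) {u : ℕ → X → Output C} (hu : ∀ n, u n ∈ F) {f : X → Output C} (hf : f ∈ F)
    (hlim : ∀ x, Tendsto (fun n => u n x) atTop (𝓝 (f x))) :
    Tendsto (fun n => sampleImpact D l z (u n)) atTop (𝓝 (sampleImpact D l z f)) := by
  have hp : ∀ p : X × Fin C,
      Tendsto (fun n => l (u n p.1) p.2) atTop (𝓝 (l (f p.1) p.2)) := fun p => by
    have hc := (hl.lipschitz p.2).continuousOn (f p.1) ⟨f, hf, _, rfl⟩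
    exact hc.tendsto.comp (tendsto_nhdsWithin_iff.2
      ⟨hlim p.1, Eventually.of_forall fun n => ⟨u n, hu n, _, rfl⟩⟩)
  refine (Tendsto.sub ?_ ?_).abs
  · refine tendsto_integral_of_dominated_convergence (fun _ => U)
      (fun n => (hl.boundedMeasurable_comp (hu n) (hF _ (hu n))).1.aestronglyMeasurable)
      (integrable_const _) (fun n => ae_of_all _ fun p => ?_) (ae_of_all _ hp)
    have h := hl.comp_mem_Icc (hu n) p
    rw [Real.norm_of_nonneg h.1]
    exact h.2
  · exact (tendsto_finsetSum _ fun i _ => hp (z i)).div_const _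

end IsRegularLoss

/-- Bound, uniform over the class of models, on the sum of the deviations between true and empirical
risks on finitely many (mutually dependent) i.i.d. samples. -/
theorem exists_event_sum_sampleImpact_le {Ω : Type*} [MeasurableSpace Ω] (μ : Measure Ω)
    [IsProbabilityMeasure μ] (D : Measure (X × Fin C)) [IsProbabilityMeasure D]
    {F : Set (X → Output C)} (hF : ∀ f ∈ F, Measurable f) (hFsep : PointwiseSeparable F)
    (hFne : F.Nonempty) {l : ℕ → Output C → Fin C → ℝ} {ρ : ℝ≥0} {U : ℝ}
    (hl : ∀ t, IsRegularLoss (l t) F ρ U)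
    {κ : ℕ → Type} [∀ t, Fintype (κ t)] [∀ t, Nonempty (κ t)]
    {z : (t : ℕ) → κ t → Ω → X × Fin C} (hz : ∀ t i, Measurable (z t i))
    (hzD : ∀ t i, μ.map (z t i) = D) (hindep : ∀ t, iIndepFun (z t) μ)
    (I : Finset ℕ) {B : ℕ → ℝ} (hB : ∀ t, 0 ≤ B t)
    (hR : ∀ t ∈ I, ENNReal.ofReal (4 * ρ) *
      ∑ y, rademacher (D.map Prod.fst) (Fintype.card (κ t)) (classOutputs F y)
        ≤ ENNReal.ofReal (B t)) {υ : ℝ} (hυ : 0 < υ) (hυ2 : υ ≤ 2) :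
    ∃ E : Set Ω, MeasurableSet E ∧ ENNReal.ofReal (1 - υ) ≤ μ E ∧ ∀ ω ∈ E,
      ∀ f : ℕ → X → Output C, (∀ t, f t ∈ F) →
        ∑ t ∈ I, sampleImpact D (l t) (fun i => z t i ω) (f t)
          ≤ ∑ t ∈ I, B t
            + U * ∑ t ∈ I, √(Real.log (2 / υ) / (2 * (Fintype.card (κ t) : ℝ))) := by
  obtain ⟨ω₀⟩ := μ.nonempty_of_neZero
  obtain ⟨p₀⟩ := D.nonempty_of_neZero
  obtain ⟨f₀, hf₀⟩ := hFne
  have hU0 : 0 ≤ U :=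
    ((hl 0).comp_mem_Icc hf₀ p₀).1.trans ((hl 0).comp_mem_Icc hf₀ p₀).2
  -- If `U = 0` the loss vanishes on the outputs; this case is separate because the tail bound needs
  -- positive scales `τ t`.
  rcases hU0.eq_or_lt with rfl | hUpos
  · refine ⟨Set.univ, .univ, ?_, fun ω _ f hf => ?_⟩
    · rw [measure_univ]
      exact ENNReal.ofReal_le_one.2 (by linarith)
    · rw [zero_mul, add_zero]
      refine sum_le_sum fun t _ => le_trans (le_of_eq ?_) (hB t)
      have h0 : ∀ p : X × Fin C, l t (f t p.1) p.2 = 0 := fun p =>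
        le_antisymm ((hl t).comp_mem_Icc (hf t) p).2 ((hl t).comp_mem_Icc (hf t) p).1
      simp [sampleImpact, trueRisk, empRisk, h0]
  rcases I.eq_empty_or_nonempty with rfl | hI
  · refine ⟨Set.univ, .univ, ?_, fun ω _ f hf => by simp⟩
    rw [measure_univ]
    exact ENNReal.ofReal_le_one.2 (by linarith)
  obtain ⟨F₀, hF₀F, hF₀c, hF₀⟩ := hFsep
  have hF₀ne : F₀.Nonempty := by
    obtain ⟨u, hu, -⟩ := hF₀ f₀ hf₀
    exact ⟨u 0, hu 0⟩
  obtain ⟨a, rfl⟩ := hF₀c.exists_eq_range hF₀ne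
  have ha : ∀ k, a k ∈ F := fun k => hF₀F ⟨k, rfl⟩
  have ham : ∀ k, Measurable (a k) := fun k => hF _ (ha k)
  have hn : ∀ t, 0 < Fintype.card (κ t) := fun t => Fintype.card_pos
  have hn' : ∀ t, (0 : ℝ) < Fintype.card (κ t) := fun t => by exact_mod_cast hn t
  set τ : ℕ → ℝ := fun t => U / (2 * √(Fintype.card (κ t))) with hτ
  have hτp : ∀ t, 0 < τ t := fun t => div_pos hUpos (mul_pos two_pos (Real.sqrt_pos.2 (hn' t)))
  set W : (t : ℕ) → Ω → Fin (Fintype.card (κ t)) → X × Fin C :=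
    fun t ω i => z t ((Fintype.equivFin (κ t)).symm i) ω with hW
  have hWm : ∀ t, Measurable (W t) := fun t => measurable_pi_iff.2 fun i => hz t _
  have hWD : ∀ t, μ.map (W t) = Measure.pi fun _ => D := fun t => by
    have h := ((hindep t).precomp (Fintype.equivFin (κ t)).symm.injective).map_fun_eq_pi_map
      fun i => (hz t _).aemeasurable
    simp only [hzD] at h
    exact h
  set G : ℕ → ℕ → Ω → ℝ := fun m t ω =>
    ⨆ k : Fin (m + 1), sampleImpact D (l t) (W t ω) (a k) with hG
  have hGb₀ : ∀ m t, BoundedMeasurable fun w : Fin (Fintype.card (κ t)) → X × Fin C =>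
      ⨆ k : Fin (m + 1), sampleImpact D (l t) w (a k) := fun m t =>
    .iSup fun k => (hl t).boundedMeasurable_sampleImpact (ha k) (ham k) D
  have hGb : ∀ m t, BoundedMeasurable (G m t) := fun m t => (hGb₀ m t).comp (hWm t)
  set Q := ∑ t ∈ I, B t + (∑ t ∈ I, τ t) * √(2 * Real.log (2 / υ)) with hQ
  have hQ' : Q = ∑ t ∈ I, B t
      + U * ∑ t ∈ I, √(Real.log (2 / υ) / (2 * (Fintype.card (κ t) : ℝ))) := by
    rw [hQ, Finset.sum_mul, Finset.mul_sum]
    congr 1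
    refine sum_congr rfl fun t _ => ?_
    have h2 : √(2 * Real.log (2 / υ)) = 2 * √(Real.log (2 / υ) / 2) := by
      rw [show 2 * Real.log (2 / υ) = 2 ^ 2 * (Real.log (2 / υ) / 2) by ring,
        Real.sqrt_mul (by norm_num), Real.sqrt_sq zero_le_two]
    rw [h2, ← div_div, Real.sqrt_div' _ (hn' t).le]
    simp only [hτ]
    field_simp
  -- These events decrease in `m` and each has probability at least `1 - υ`, so their intersection
  -- does too.
  let A : ℕ → Set Ω := fun m => {ω | ∑ t ∈ I, G m t ω ≤ Q}
  have hmem : ∀ {m ω}, ω ∈ A m ↔ ∑ t ∈ I, G m t ω ≤ Q := Iff.rfl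
  have hAm : ∀ m, MeasurableSet (A m) := fun m =>
    measurableSet_le (BoundedMeasurable.sum (s := I) (hGb m)).1 measurable_const
  have hAanti : Antitone A := fun m m' hmm ω hω => by
    refine le_trans (sum_le_sum fun t _ => ciSup_le fun k => ?_) (hmem.1 hω)
    exact le_ciSup_of_finite (fun k : Fin (m' + 1) => sampleImpact D (l t) (W t ω) (a k))
      (Fin.castLE (by omega) k)
  have hAμ : ∀ m, ENNReal.ofReal (1 - υ) ≤ μ (A m) := fun m => by
    have h := measureReal_sum_ge_le μ hI (hGb m) (B := B) hτp (fun t ht s hs => by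
      have h := (hl t).integral_exp_iSup_sampleImpact_le (fun k : Fin (m + 1) => ha k)
        (fun k => ham k) D (hn t) (hB t) (hR t ht) hs
      rwa [← hWD t, integral_map (hWm t).aemeasurable
        ((hGb₀ m t).const_mul s).exp.1.aestronglyMeasurable] at h) hυ hυ2
    have h2 : μ.real (A m)ᶜ ≤ υ := by
      refine (measureReal_mono (fun ω hω => ?_) (measure_ne_top μ _)).trans h
      exact (not_le.1 fun hle => hω (hmem.2 hle)).le
    rw [measureReal_compl (hAm m), probReal_univ] at h2
    rw [← ofReal_measureReal (measure_ne_top μ _)]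
    exact ENNReal.ofReal_le_ofReal (by linarith)
  refine ⟨⋂ m, A m, .iInter hAm, ?_, fun ω hω f hf => ?_⟩
  · exact ge_of_tendsto' (tendsto_measure_iInter_atTop (fun m => (hAm m).nullMeasurableSet) hAanti
      ⟨0, measure_ne_top μ _⟩) hAμ
  · rw [← hQ']
    choose u hu hlim using fun t => hF₀ (f t) (hf t)
    refine le_of_tendsto' (tendsto_finsetSum I fun t _ => (hl t).tendsto_sampleImpact hF D
      (fun i => z t i ω) (fun n => hF₀F (hu t n)) (hf t) (hlim t)) fun n => ?_
    -- For fixed `n`, the approximants of the finitely many steps in `I` all occur among the first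
    -- `I.sup k + 1` models, so a single event `A m` covers them.
    choose k hk using fun t => hu t n
    have hm := hmem.1 (Set.mem_iInter.1 hω (I.sup k))
    refine le_trans (sum_le_sum fun t ht => ?_) hm
    rw [← hk t, ← sampleImpact_comp_equiv D (l t) (Fintype.equivFin (κ t)).symm]
    exact le_ciSup_of_finite (fun k : Fin (I.sup k + 1) => sampleImpact D (l t) (W t ω) (a k))
      ⟨k t, Nat.lt_succ_of_le (Finset.le_sup ht)⟩

end UniformDeviation

/-! ### The logit-adjusted loss, label noise and the risk recursion. -/

section LogitAdjustedLoss

variable {C : ℕ}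

/-- A softmax ratio is at most `1`. With the upper bound `U`, this confines the loss to an interval
of length `U`, as McDiarmid and the noise bound require. -/
theorem laLoss_nonneg {P : Fin C → ℝ} (z : Fin C → ℝ) (y : Fin C) : 0 ≤ laLoss P z y := by
  rw [laLoss, neg_nonneg]
  have hs : ∀ y', 0 < Real.exp (z y' + Real.log (P y')) := fun y' => Real.exp_pos _
  have hle : Real.exp (z y + Real.log (P y)) ≤ ∑ y', Real.exp (z y' + Real.log (P y')) :=
    single_le_sum (f := fun y' => Real.exp (z y' + Real.log (P y'))) (fun y' _ => (hs y').le)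
      (mem_univ y)
  exact Real.log_nonpos (div_nonneg (hs y).le ((hs y).le.trans hle))
    (div_le_one_of_le₀ hle ((hs y).le.trans hle))

theorem measurable_outputLoss {P : Fin C → ℝ} {L : Output C → Fin C → ℝ} (hL : Measurable L)
    (y : Fin C) : Measurable fun u => outputLoss P L u y := by
  have hLy : ∀ y, Measurable fun u => L u y := fun y => (measurable_pi_apply y).comp hL
  unfold outputLoss laLoss
  exact (Real.measurable_log.comp (((hLy y).add_const _).exp.div
    (Finset.measurable_sum _ fun y' _ => ((hLy y').add_const _).exp))).neg

theorem noiseImpact_le {X : Type*} {m : ℕ} {l : Output C → Fin C → ℝ} {f : X → Output C} {U : ℝ}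
    (hl : ∀ x y, l (f x) y ∈ Set.Icc 0 U) (s : Fin m → X × Fin C) (yhat : Fin m → Fin C) :
    noiseImpact l s yhat f ≤ U * errorRate s yhat := by
  have h : ∀ j, |l (f (s j).1) (yhat j) - l (f (s j).1) (s j).2|
      ≤ U * if yhat j ≠ (s j).2 then 1 else 0 := fun j => by
    have h1 := hl (s j).1 (yhat j)
    have h2 := hl (s j).1 (s j).2
    split_ifs with hj
    · rw [abs_le]
      constructor <;> linarith [h1.1, h1.2, h2.1, h2.2]
    · rw [not_ne_iff.1 hj]; simp
  rw [noiseImpact, empRisk, empRisk, errorRate, ← sub_div, ← sum_sub_distrib, abs_div,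
    Fintype.card_fin, Nat.abs_cast, ← mul_div_assoc]
  refine div_le_div_of_nonneg_right ((abs_sum_le_sum_abs _ _).trans
    ((sum_le_sum fun j _ => h j).trans (le_of_eq ?_))) (Nat.cast_nonneg m)
  rw [← Finset.mul_sum, Finset.sum_boole]

theorem modelRisk_eq (R₀ : ℝ) (lam Ieps Isam : ℕ → ℝ) (T : ℕ) :
    modelRisk R₀ lam Ieps Isam T = R₀ - ∑ t ∈ Icc 1 T, lam t + ∑ t ∈ Icc 1 T, Ieps t
      + ∑ t ∈ Icc 1 T, Isam t := by
  induction T with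
  | zero => simp [modelRisk]
  | succ T ih =>
    rw [modelRisk, ih, sum_Icc_succ_top (by omega), sum_Icc_succ_top (by omega),
      sum_Icc_succ_top (by omega)]
    ring

end LogitAdjustedLoss

end CPG

end

/-! ### Assembly of the risk bound. -/

theorem theorem1 {X Ω : Type*} [MeasurableSpace X] [MeasurableSpace Ω] {C : ℕ}
    -- probability space, and law of a data point with its true label
    (μ : Measure Ω) [IsProbabilityMeasure μ]
    (D : Measure (X × Fin C)) [IsProbabilityMeasure D]
    -- class of models
    (F : Set (X → CPG.Output C)) (hF : ∀ f ∈ F, Measurable f) (hFsep : CPG.PointwiseSeparable F)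
    -- class priors used at step `t`, and the map from outputs to logits
    (P : ℕ → Fin C → ℝ) (hPpos : ∀ t y, 0 < P t y) (hPsum : ∀ t, ∑ y, P t y = 1)
    (L : CPG.Output C → Fin C → ℝ) (hL : Measurable L)
    -- the loss is Lipschitz in the output and bounded
    (ρ : ℝ≥0)
    (hLip : ∀ t y, LipschitzOnWith ρ (fun u => CPG.outputLoss (P t) L u y) (CPG.outputs F))
    (U : ℝ) (hU : ∀ t y, ∀ u ∈ CPG.outputs F, CPG.outputLoss (P t) L u y ≤ U)
    -- labeled sample, and sample selected for pseudo-labeling at step `t`, with true labels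
    (N : ℕ) (hN : 0 < N) (lab : Fin N → Ω → X × Fin C)
    (Mhat : ℕ → ℕ) (sel : (t : ℕ) → Fin (Mhat t) → Ω → X × Fin C)
    (hlab : ∀ i, Measurable (lab i)) (hsel : ∀ t j, Measurable (sel t j))
    (hlabD : ∀ i, μ.map (lab i) = D) (hselD : ∀ t j, μ.map (sel t j) = D)
    (hindep : ∀ t, iIndepFun (fun k : Fin N ⊕ Fin (Mhat t) => Sum.elim lab (sel t) k) μ)
    -- pseudo-labels, trained models and risk reductions, all possibly depending on all the data
    (yhat : (t : ℕ) → Fin (Mhat t) → Ω → Fin C)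
    (f : ℕ → Ω → X → CPG.Output C) (hf : ∀ t ω, f t ω ∈ F)
    (lam : ℕ → Ω → ℝ) (hlam : ∀ t ω, 0 ≤ lam t ω)
    (T : ℕ) (υ : ℝ) (hυ : 0 < υ) :
    let R₀ : Ω → ℝ := fun ω =>
      CPG.empRisk (CPG.outputLoss (P 0) L) (fun i => lab i ω) (f 0 ω)
    let Ieps : Ω → ℕ → ℝ := fun ω t =>
      CPG.noiseImpact (CPG.outputLoss (P t) L) (fun j => sel t j ω) (fun j => yhat t j ω) (f t ω)
    let Isam : Ω → ℕ → ℝ := fun ω t =>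
      CPG.sampleImpact D (CPG.outputLoss (P t) L)
        (fun k : Fin N ⊕ Fin (Mhat t) => Sum.elim lab (sel t) k ω) (f t ω)
    let R : ℕ → Ω → ℝ := fun t ω =>
      CPG.modelRisk (R₀ ω) (fun s => lam s ω) (Ieps ω) (Isam ω) t
    let ε : ℕ → Ω → ℝ := fun t ω =>
      CPG.errorRate (fun j => sel t j ω) (fun j => yhat t j ω)
    let O : ℕ → ℕ := fun t => N + Mhat t
    ∃ E : Set Ω, MeasurableSet E ∧ ENNReal.ofReal (1 - υ) ≤ μ E ∧ ∀ ω ∈ E,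
      (R T ω : EReal) ≤
        ((R₀ ω - ∑ t ∈ Finset.Icc 1 T, lam t ω + U * ∑ t ∈ Finset.Icc 1 T, ε t ω : ℝ) : EReal)
        + ((ENNReal.ofReal (4 * √2 * ρ) * ∑ t ∈ Finset.Icc 1 T, ∑ y : Fin C,
            CPG.rademacher (D.map Prod.fst) (O t) (CPG.classOutputs F y) : ℝ≥0∞) : EReal)
        + ((2 * U * ∑ t ∈ Finset.Icc 1 T, √(Real.log (2 / υ) / (2 * (O t : ℝ))) : ℝ) : EReal) := by
  intro R₀ Ieps Isam R ε O
  rcases le_or_gt 1 υ with hυ1 | hυ1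
  · exact ⟨∅, .empty, by rw [ENNReal.ofReal_of_nonpos (by linarith)]; exact zero_le,
      fun ω hω => hω.elim⟩
  obtain ⟨ω₀⟩ := μ.nonempty_of_neZero
  have hFne : F.Nonempty := ⟨f 0 ω₀, hf 0 ω₀⟩
  have hl : ∀ t, CPG.IsRegularLoss (CPG.outputLoss (P t) L) F ρ U := fun t =>
    ⟨CPG.measurable_outputLoss hL, fun _ _ => CPG.laLoss_nonneg _ _, hU t, hLip t⟩
  set S : ℕ → ℝ≥0∞ := fun t =>
    ∑ y : Fin C, CPG.rademacher (D.map Prod.fst) (O t) (CPG.classOutputs F y) with hS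
  -- An infinite complexity term makes the bound trivial. For `ρ = 0` the product is `0` by the
  -- convention `0 * ⊤ = 0`, so that case falls under the finite branch.
  by_cases htop : ENNReal.ofReal (4 * √2 * ρ) * ∑ t ∈ Finset.Icc 1 T, S t = ⊤
  · refine ⟨Set.univ, .univ, ?_, fun ω _ => ?_⟩
    · rw [measure_univ]
      exact ENNReal.ofReal_le_one.2 (by linarith)
    · rw [htop, EReal.coe_ennreal_top, EReal.coe_add_top, EReal.top_add_coe]
      exact le_top
  have hfin : ∀ t ∈ Finset.Icc 1 T, ENNReal.ofReal (4 * √2 * ρ) * S t ≠ ⊤ := by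
    rw [Finset.mul_sum] at htop
    exact fun t ht => ENNReal.sum_ne_top.1 htop t ht
  have : Nonempty (Fin N) := ⟨⟨0, hN⟩⟩
  have hcard : ∀ t, Fintype.card (Fin N ⊕ Fin (Mhat t)) = O t := fun t => by simp [O]
  obtain ⟨E, hE, hμE, hbound⟩ := CPG.exists_event_sum_sampleImpact_le μ D hF hFsep hFne hl
    (κ := fun t => Fin N ⊕ Fin (Mhat t)) (z := fun t => Sum.elim lab (sel t))
    (by rintro t (i | j); exacts [hlab i, hsel t j])
    (by rintro t (i | j); exacts [hlabD i, hselD t j]) hindep (Finset.Icc 1 T)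
    (B := fun t => (ENNReal.ofReal (4 * √2 * ρ) * S t).toReal)
    (fun t => ENNReal.toReal_nonneg)
    (fun t ht => by
      rw [ENNReal.ofReal_toReal (hfin t ht), hcard]
      -- The slack between the proved `4ρ` and the stated `4√2 ρ` is given away here.
      have h2 : (1 : ℝ) ≤ √2 := Real.one_le_sqrt.2 one_le_two
      refine mul_le_mul_left (ENNReal.ofReal_le_ofReal ?_) _
      have := mul_le_mul_of_nonneg_right h2 ρ.2
      simp only [NNReal.val_eq_coe] at this
      linarith) hυ (by linarith)
  refine ⟨E, hE, hμE, fun ω hω => ?_⟩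
  have hsam := hbound ω hω (fun t => f t ω) fun t => hf t ω
  have heps : ∑ t ∈ Finset.Icc 1 T, Ieps ω t ≤ U * ∑ t ∈ Finset.Icc 1 T, ε t ω := by
    rw [Finset.mul_sum]
    exact Finset.sum_le_sum fun t _ => CPG.noiseImpact_le
      (fun x y => (hl t).comp_mem_Icc (hf t ω) (x, y)) _ _
  obtain ⟨p₀⟩ := D.nonempty_of_neZero
  have hU0 : 0 ≤ U := ((hl 0).comp_mem_Icc (hf 0 ω) p₀).1.trans
    ((hl 0).comp_mem_Icc (hf 0 ω) p₀).2
  -- Nonnegativity allows the proved coefficient `U` to be replaced by `2 * U`.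
  have hdev : 0 ≤ U * ∑ t ∈ Finset.Icc 1 T, √(Real.log (2 / υ) / (2 * (O t : ℝ))) :=
    mul_nonneg hU0 (Finset.sum_nonneg fun t _ => Real.sqrt_nonneg _)
  simp only [hcard] at hsam
  rw [← EReal.coe_ennreal_toReal htop, ← EReal.coe_add, ← EReal.coe_add, EReal.coe_le_coe_iff,
    show (ENNReal.ofReal (4 * √2 * ρ) * ∑ t ∈ Finset.Icc 1 T, S t).toReal
      = ∑ t ∈ Finset.Icc 1 T, (ENNReal.ofReal (4 * √2 * ρ) * S t).toReal by
        rw [Finset.mul_sum, ENNReal.toReal_sum hfin]]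
  change CPG.modelRisk _ _ _ _ T ≤ _
  rw [CPG.modelRisk_eq]
  change ∑ t ∈ Finset.Icc 1 T, Isam ω t ≤ _ at hsam
  linarith
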